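/- Let $1<p<5$ and $g(r)=r|r|^{p-1}$. Let $C_D([0,1])$ be the space of continuous functions $v:[0,1]\to\mathbb R$ with $v(0)=v(1)=0$, endowed with the supremum norm $\|\cdot\|_\infty$. Define $S:C_D([0,1])\to(-\infty,+\infty]$ by $$S(v)=\int_0^1\Big[\tfrac12\Big(\tfrac{dv}{dx}\Big)^2-\tfrac{|v|^{p+1}}{p+1}\Big]dx\quad\text{if } v\in H^1_0((0,1)),\qquad S(v)=+\infty\ \text{ otherwise},$$ where $\frac{dv}{dx}$ is the weak derivative of $v$. Let $\mathcal D_{\mathbf 0}\subseteq C_D([0,1])$ be the set of all $u$ for which the problem $$\partial_tU=\partial^2_{xx}U+g(U)\ \ (t>0,\ 0<x<1),\qquad U(t,0)=U(t,1)=0,\qquad U(0,\cdot)=u$$ has a globally defined classical solution $U\in C([0,\infty)\times[0,1])\cap C^{1,2}((0,\infty)\times[0,1])$ (one time derivative and two space derivatives, continuous up to the boundary of $[0,1]$) with $\|U(t,\cdot)\|_\infty\to0$ as $t\to\infty$, and let $\overline{\mathcal D_{\mathbf 0}}$ be its closure in $C_D([0,1])$. Then for every $a>0$ the set $\{u\in\overline{\mathcal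 D_{\mathbf 0}}: S(u)\le a\}$ is bounded in the supremum norm, i.e. there is $M<\infty$, depending only on $p$ and $a$, such that $\|u\|_\infty\le M$ for every $u$ in this set. -/

import Mathlib

open Set Filter Topology MeasureTheory
open scoped ContDiff

noncomputable section

namespace BlowUpPDE

/-- The space `C_D([0,1])` of continuous functions on `[0,1]` vanishing at `0` and `1`, with the
metric induced by the supremum norm of `C([0,1])`. -/
abbrev CD : Type := {v : C(unitInterval, ℝ) // v 0 = 0 ∧ v 1 = 0}

/-- A function of `C_D([0,1])` seen as a function on `ℝ` (extended by its boundary values `0`). -/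
def CD.toReal (v : CD) : ℝ → ℝ := IccExtend zero_le_one (v.1 : unitInterval → ℝ)

/-- The source term `g(r) = r |r|^(p-1)`. -/
def source (p r : ℝ) : ℝ := r * |r| ^ (p - 1)

/-- `w` is a square-integrable weak derivative of `f` on the open interval `(0,1)`. -/
structure IsL2WeakDeriv (f w : ℝ → ℝ) : Prop where
  memLp : MemLp w 2 (volume.restrict (Ioo (0 : ℝ) 1))
  weak : ∀ φ : ℝ → ℝ, ContDiff ℝ ∞ φ → HasCompactSupport φ → tsupport φ ⊆ Ioo (0 : ℝ) 1 →
    ∫ x in Ioo (0 : ℝ) 1, f x * deriv φ x = - ∫ x in Ioo (0 : ℝ) 1, w x * φ x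

/-- Membership of `v ∈ C_D([0,1])` in `H¹₀((0,1))`: as `v` is continuous and vanishes at the
boundary, this says that `v` has a square-integrable weak derivative. -/
def MemH10 (v : CD) : Prop := ∃ w : ℝ → ℝ, IsL2WeakDeriv v.toReal w

open Classical in
/-- The weak derivative of `v` on `(0,1)` (unique up to null sets) if `v ∈ H¹₀((0,1))`. -/
def weakDeriv (v : CD) : ℝ → ℝ := if h : MemH10 v then h.choose else 0

open Classical in
/-- The potential `S`, with values in the extended reals: `+∞` off `H¹₀((0,1))`. -/
def potential (p : ℝ) (v : CD) : EReal :=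
  if MemH10 v then
    ((∫ x in Ioo (0 : ℝ) 1,
      ((1 / 2) * weakDeriv v x ^ 2 - |v.toReal x| ^ (p + 1) / (p + 1)) : ℝ) : EReal)
  else ⊤

/-- `U` (first argument time, second argument space) is a globally defined classical solution of
`∂ₜU = ∂ₓₓU + g(U)` with homogeneous Dirichlet boundary conditions and initial datum `u`:
it is continuous on `[0,∞) × [0,1]`, and on `(0,∞) × [0,1]` the derivatives `∂ₓU`, `∂ₓₓU`, `∂ₜU`
exist (one-sided in space at the end points), are continuous and satisfy the equation. (Continuity
of `∂ₜU` is automatic from the equation.) -/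
structure IsGlobalSolution (p : ℝ) (u : CD) (U : ℝ → ℝ → ℝ) : Prop where
  continuousOn : ContinuousOn (Function.uncurry U) (Ici (0 : ℝ) ×ˢ Icc (0 : ℝ) 1)
  initial : ∀ x : unitInterval, U 0 (x : ℝ) = u.1 x
  left_boundary : ∀ t : ℝ, 0 ≤ t → U t 0 = 0
  right_boundary : ∀ t : ℝ, 0 ≤ t → U t 1 = 0
  equation : ∃ Ux Uxx : ℝ → ℝ → ℝ,
    ContinuousOn (Function.uncurry Ux) (Ioi (0 : ℝ) ×ˢ Icc (0 : ℝ) 1) ∧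
    ContinuousOn (Function.uncurry Uxx) (Ioi (0 : ℝ) ×ˢ Icc (0 : ℝ) 1) ∧
    ∀ t : ℝ, 0 < t → ∀ x ∈ Icc (0 : ℝ) 1,
      HasDerivWithinAt (U t) (Ux t x) (Icc (0 : ℝ) 1) x ∧
      HasDerivWithinAt (Ux t) (Uxx t x) (Icc (0 : ℝ) 1) x ∧
      HasDerivAt (fun s => U s x) (Uxx t x + source p (U t x)) t

/-- The domain of attraction `D_0` of the null function: the initial data whose solution is
globally defined and converges to `0` in the supremum norm as `t → ∞`. -/
def domainOfAttraction (p : ℝ) : Set CD :=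
  {u | ∃ U : ℝ → ℝ → ℝ, IsGlobalSolution p u U ∧
    TendstoUniformlyOn U (fun _ => 0) atTop (Icc (0 : ℝ) 1)}

end BlowUpPDE

end

/-! The sup norm interpolates between `L²` and `H¹₀`: `‖v‖⁴ ≤ 4 ∫ v'² ∫ v²`. A bound `S(v) ≤ a`
controls `∫ v'²` by `a` and `∫ |v|^(p+1) ≤ ‖v‖^(p-1) ∫ v²`. Given a bound on `∫ v²`, this yields
`‖v‖⁴ ≤ C ‖v‖^(p-1)` when `‖v‖ ≥ 1`, hence a bound on `‖v‖` because `p < 5`.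

It remains to bound `∫ v²`. Along a solution the energy decreases, and `y = ∫ U²` satisfies `y' =
-4E + 2 (p-1)/(p+1) ∫ |U|^(p+1)`. By Jensen, `y' ≥ c y^((p+1)/2)` once `y` is large compared with
the energy, so a large `y` would blow up in finite time. Global solutions thus have `y` bounded in
terms of their energy (`exists_integral_sq_le`).

To pass to the closure, approximate `v` uniformly by `u` in the domain of attraction. Uniform
closeness does not control the energy of `u`, but the flow does: if `∫ U_x²` exceeded `∫ v'² + 1`
throughout a short time interval, the `L²` distance from `U` to `v` would become negative. Hence at
some small positive time `U` is `L²`-close to `v` and has energy at most `S(v) + 1`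
(`exists_time_energy_le`), and the previous bound applies to it. -/

noncomputable section

namespace BlowUpPDE

/-! ### Weak derivatives and primitives. -/

/-- Integration by parts for two primitives of integrable functions. -/
theorem integral_mul_eq_sub_of_primitive {f g w v : ℝ → ℝ} {b : ℝ} (hb : 0 ≤ b)
    (hw : IntervalIntegrable w volume 0 b) (hv : IntervalIntegrable v volume 0 b)
    (hf : ∀ x ∈ Icc 0 b, f x = f 0 + ∫ y in (0 : ℝ)..x, w y)
    (hg : ∀ x ∈ Icc 0 b, g x = g 0 + ∫ y in (0 : ℝ)..x, v y) :
    ∫ x in (0 : ℝ)..b, f x * v x = f b * g b - f 0 * g 0 - ∫ x in (0 : ℝ)..b, w x * g x := by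
  set F : ℝ → ℝ := fun x => ∫ y in (0 : ℝ)..x, w y with hF
  set G : ℝ → ℝ := fun x => ∫ y in (0 : ℝ)..x, v y with hG
  have hFac : AbsolutelyContinuousOnInterval F 0 b :=
    hw.absolutelyContinuousOnInterval_intervalIntegral left_mem_uIcc
  have hGac : AbsolutelyContinuousOnInterval G 0 b :=
    hv.absolutelyContinuousOnInterval_intervalIntegral left_mem_uIcc
  have hF' : AbsolutelyContinuousOnInterval (fun x => f 0 + F x) 0 b := by
    have : AbsolutelyContinuousOnInterval (fun _ : ℝ => f 0) 0 b :=
      (LipschitzWith.const (f 0)).lipschitzOnWith.absolutelyContinuousOnInterval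
    exact this.add hFac
  have hG' : AbsolutelyContinuousOnInterval (fun x => g 0 + G x) 0 b := by
    have : AbsolutelyContinuousOnInterval (fun _ : ℝ => g 0) 0 b :=
      (LipschitzWith.const (g 0)).lipschitzOnWith.absolutelyContinuousOnInterval
    exact this.add hGac
  have key := hF'.integral_mul_deriv_eq_deriv_mul hG'
  have hdF : ∀ᵐ x, x ∈ uIoc 0 b → deriv (fun x => f 0 + F x) x = w x := by
    filter_upwards [hw.ae_hasDerivAt_integral] with x hx hxm
    exact ((hx (uIoc_subset_uIcc hxm) 0 left_mem_uIcc).const_add _).deriv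
  have hdG : ∀ᵐ x, x ∈ uIoc 0 b → deriv (fun x => g 0 + G x) x = v x := by
    filter_upwards [hv.ae_hasDerivAt_integral] with x hx hxm
    exact ((hx (uIoc_subset_uIcc hxm) 0 left_mem_uIcc).const_add _).deriv
  have e1 : ∫ x in (0 : ℝ)..b, f x * v x =
      ∫ x in (0 : ℝ)..b, (f 0 + F x) * deriv (fun x => g 0 + G x) x := by
    apply intervalIntegral.integral_congr_ae
    filter_upwards [hdG] with x hx hxm
    rw [hx hxm, hf x]
    rw [uIoc_of_le hb] at hxm
    exact Ioc_subset_Icc_self hxm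
  have e2 : ∫ x in (0 : ℝ)..b, w x * g x =
      ∫ x in (0 : ℝ)..b, deriv (fun x => f 0 + F x) x * (g 0 + G x) := by
    apply intervalIntegral.integral_congr_ae
    filter_upwards [hdF] with x hx hxm
    rw [hx hxm, hg x]
    rw [uIoc_of_le hb] at hxm
    exact Ioc_subset_Icc_self hxm
  rw [e1, e2, key, hf b (right_mem_Icc.2 hb), hg b (right_mem_Icc.2 hb)]
  simp [hF, hG]

/-- The **du Bois-Reymond lemma** on `(0,1)` for functions continuous on `[0,1]`. -/
theorem eq_const_of_integral_mul_deriv_eq_zero {h : ℝ → ℝ} (hc : ContinuousOn h (Icc 0 1))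
    (H : ∀ φ : ℝ → ℝ, ContDiff ℝ ∞ φ → HasCompactSupport φ → tsupport φ ⊆ Ioo (0 : ℝ) 1 →
      ∫ x in Ioo (0 : ℝ) 1, h x * deriv φ x = 0) :
    ∃ C, ∀ x ∈ Icc (0 : ℝ) 1, h x = C := by
  let B : ContDiffBump (1 / 2 : ℝ) := ⟨1 / 8, 1 / 4, by norm_num, by norm_num⟩
  set ψ : ℝ → ℝ := B.normed volume with hψ
  have hψs : ContDiff ℝ ∞ ψ := B.contDiff_normed
  have hψi : ∫ x, ψ x = 1 := B.integral_normed
  have hψt : tsupport ψ ⊆ Ioo 0 1 := by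
    rw [hψ, B.tsupport_normed_eq, Real.closedBall_eq_Icc]
    intro x hx
    simp only [B, mem_Icc, mem_Ioo] at hx ⊢
    constructor <;> linarith [hx.1, hx.2]
  have hψc : HasCompactSupport ψ := B.hasCompactSupport_normed
  have hint : ∀ φ : ℝ → ℝ, Continuous φ →
      IntegrableOn (fun x => h x * φ x) (Ioo 0 1) := fun φ hφ =>
    ((hc.mul hφ.continuousOn).integrableOn_Icc).mono_set Ioo_subset_Icc_self
  set C := ∫ x in Ioo (0 : ℝ) 1, h x * ψ x with hC
  have hfull : ∀ φ : ℝ → ℝ, tsupport φ ⊆ Ioo (0 : ℝ) 1 →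
      ∫ x in (0 : ℝ)..1, φ x = ∫ x, φ x := by
    intro φ hφ
    rw [intervalIntegral.integral_of_le zero_le_one]
    exact setIntegral_eq_integral_of_forall_compl_eq_zero fun x hx =>
      image_eq_zero_of_notMem_tsupport fun hx' => hx (Ioo_subset_Ioc_self (hφ hx'))
  have main : ∀ φ : ℝ → ℝ, ContDiff ℝ ∞ φ → HasCompactSupport φ → tsupport φ ⊆ Ioo (0 : ℝ) 1 →
      ∫ x in Ioo (0 : ℝ) 1, (h x - C) * φ x = 0 := by
    intro φ hφ hφc hφt
    set c := ∫ x, φ x with hcdef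
    -- Subtracting `c * ψ` gives `η` mean zero, so its primitive `Φ` has compact support in `(0,1)`
    -- and is an admissible test function.
    set η : ℝ → ℝ := fun x => φ x - c * ψ x with hη
    have hηs : ContDiff ℝ ∞ η := hφ.sub (contDiff_const.mul hψs)
    set Φ : ℝ → ℝ := fun x => ∫ y in (0 : ℝ)..x, η y with hΦ
    have hΦd : ∀ x, HasDerivAt Φ (η x) x := fun x =>
      intervalIntegral.integral_hasDerivAt_right (hηs.continuous.intervalIntegrable _ _)
        (hηs.continuous.stronglyMeasurableAtFilter _ _) hηs.continuous.continuousAt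
    have hdΦ : deriv Φ = η := funext fun x => (hΦd x).deriv
    have hΦs : ContDiff ℝ ∞ Φ :=
      contDiff_infty_iff_deriv.2 ⟨fun x => (hΦd x).differentiableAt, hdΦ ▸ hηs⟩
    obtain ⟨α, β, hα, hβ, hK⟩ : ∃ α β : ℝ, 0 < α ∧ β < 1 ∧
        tsupport φ ∪ tsupport ψ ⊆ Icc α β := by
      have hKc : IsCompact (tsupport φ ∪ tsupport ψ) := IsCompact.union hφc hψc
      have hne : (tsupport φ ∪ tsupport ψ).Nonempty := by
        refine Set.Nonempty.inr ?_
        rw [hψ, B.tsupport_normed_eq]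
        exact ⟨1 / 2, Metric.mem_closedBall_self B.rOut_pos.le⟩
      have hsub : tsupport φ ∪ tsupport ψ ⊆ Ioo 0 1 := union_subset hφt hψt
      refine ⟨sInf (tsupport φ ∪ tsupport ψ), sSup (tsupport φ ∪ tsupport ψ),
        (hsub (hKc.sInf_mem hne)).1, (hsub (hKc.sSup_mem hne)).2, fun x hx =>
        ⟨csInf_le hKc.bddBelow hx, le_csSup hKc.bddAbove hx⟩⟩
    have hη0 : ∀ x, x ∉ Icc α β → η x = 0 := by
      intro x hx
      have h1 : φ x = 0 := image_eq_zero_of_notMem_tsupport fun h => hx (hK (Or.inl h))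
      have h2 : ψ x = 0 := image_eq_zero_of_notMem_tsupport fun h => hx (hK (Or.inr h))
      simp [hη, h1, h2]
    have hη1 : ∫ x in (0 : ℝ)..1, η x = 0 := by
      have i2 : IntervalIntegrable (fun x => c * ψ x) volume 0 1 :=
        (continuous_const.mul hψs.continuous).intervalIntegrable _ _
      simp only [hη]
      rw [intervalIntegral.integral_sub (hφ.continuous.intervalIntegrable _ _) i2,
        intervalIntegral.integral_const_mul, hfull φ hφt, hfull ψ hψt, hψi]
      simp [hcdef]
    have hΦ0 : ∀ x, x ∉ Icc α β → Φ x = 0 := by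
      intro x hx
      rcases lt_or_ge x α with hxa | hxa
      · refine intervalIntegral.integral_zero_ae (Eventually.of_forall fun y hy => hη0 y ?_)
        have : y < α := by
          rcases le_total 0 x with h0 | h0
          · rw [uIoc_of_le h0] at hy; exact hy.2.trans_lt hxa
          · rw [uIoc_of_ge h0] at hy; exact hy.2.trans_lt hα
        exact fun h => absurd h.1 (not_le.2 this)
      · have hxb : β < x := by
          by_contra hcon
          exact hx ⟨hxa, not_lt.1 hcon⟩
        -- To the right of `β`, `Φ` is the total integral of `η`, which is zero, plus an integral
        -- over points where `η` vanishes.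
        have hs : Φ x = (∫ y in (0 : ℝ)..1, η y) + ∫ y in (1 : ℝ)..x, η y :=
          (intervalIntegral.integral_add_adjacent_intervals
            (hηs.continuous.intervalIntegrable _ _) (hηs.continuous.intervalIntegrable _ _)).symm
        rw [hs, hη1, zero_add]
        refine intervalIntegral.integral_zero_ae (Eventually.of_forall fun y hy => hη0 y ?_)
        have : β < y := by
          rcases le_total 1 x with h0 | h0
          · rw [uIoc_of_le h0] at hy; exact hβ.trans hy.1
          · rw [uIoc_of_ge h0] at hy; exact hxb.trans hy.1
        exact fun h => absurd h.2 (not_le.2 this)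
    have hΦt : tsupport Φ ⊆ Icc α β :=
      closure_minimal (fun x hx => by_contra fun hx' => hx (hΦ0 x hx')) isClosed_Icc
    have hz := H Φ hΦs (HasCompactSupport.intro isCompact_Icc hΦ0)
      (hΦt.trans fun x hx => ⟨hα.trans_le hx.1, hx.2.trans_lt hβ⟩)
    rw [hdΦ] at hz
    have e1 : ∫ x in Ioo (0 : ℝ) 1, h x * η x =
        (∫ x in Ioo (0 : ℝ) 1, h x * φ x) - c * C := by
      rw [hC, ← integral_const_mul, ← integral_sub (hint φ hφ.continuous)
        ((hint ψ hψs.continuous).const_mul c)]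
      refine integral_congr_ae (Eventually.of_forall fun x => ?_)
      simp only [hη]; ring
    have e2 : ∫ x in Ioo (0 : ℝ) 1, (h x - C) * φ x =
        (∫ x in Ioo (0 : ℝ) 1, h x * φ x) - C * c := by
      have e3 : c = ∫ x in Ioo (0 : ℝ) 1, φ x := by
        rw [hcdef, ← hfull φ hφt, intervalIntegral.integral_of_le zero_le_one,
          integral_Ioc_eq_integral_Ioo]
      rw [e3, ← integral_const_mul, ← integral_sub (hint φ hφ.continuous)]
      · refine integral_congr_ae (Eventually.of_forall fun x => ?_)
        simp only; ring
      · exact ((continuous_const.mul hφ.continuous).integrableOn_Icc (a := 0) (b := 1)).mono_set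
          Ioo_subset_Icc_self
    rw [e2]; rw [e1] at hz; linarith
  have hae : ∀ᵐ x ∂volume, x ∈ Ioo (0 : ℝ) 1 → h x - C = 0 := by
    refine isOpen_Ioo.ae_eq_zero_of_integral_contDiff_smul_eq_zero ?_ ?_
    · exact (((hc.sub continuousOn_const).integrableOn_Icc (μ := volume)).mono_set
        Ioo_subset_Icc_self).locallyIntegrableOn
    · intro φ hφ hφc hφt
      have := main φ hφ hφc hφt
      rw [← this, ← setIntegral_eq_integral_of_forall_compl_eq_zero (s := Ioo (0 : ℝ) 1)]
      · refine integral_congr_ae (Eventually.of_forall fun x => ?_)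
        simp only [smul_eq_mul]; ring
      · intro x hx
        rw [image_eq_zero_of_notMem_tsupport fun hx' => hx (hφt hx'), zero_smul]
  refine ⟨C, fun x hx => ?_⟩
  have hopen : EqOn h (fun _ => C) (Ioo 0 1) := by
    refine Measure.eqOn_open_of_ae_eq (μ := volume) ?_ isOpen_Ioo
      (hc.mono Ioo_subset_Icc_self) continuousOn_const
    rw [EventuallyEq, ae_restrict_iff' measurableSet_Ioo]
    filter_upwards [hae] with y hy hym
    exact sub_eq_zero.1 (hy hym)
  refine hopen.of_subset_closure hc continuousOn_const Ioo_subset_Icc_self ?_ hx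
  rw [closure_Ioo zero_ne_one]

theorem CD.continuous_toReal (v : CD) : Continuous v.toReal := v.1.continuous.Icc_extend'

theorem CD.toReal_zero (v : CD) : v.toReal 0 = 0 := by
  rw [CD.toReal, IccExtend_left]; exact v.2.1

theorem CD.toReal_one (v : CD) : v.toReal 1 = 0 := by
  rw [CD.toReal, IccExtend_right]; exact v.2.2

theorem CD.toReal_coe (v : CD) (x : unitInterval) : v.toReal x = v.1 x :=
  IccExtend_val _ _ x

theorem IsL2WeakDeriv.integrable_sq {f w : ℝ → ℝ} (h : IsL2WeakDeriv f w) :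
    IntervalIntegrable (fun x => w x ^ 2) volume 0 1 := by
  rw [intervalIntegrable_iff_integrableOn_Ioo_of_le zero_le_one]
  exact h.memLp.integrable_sq

theorem IsL2WeakDeriv.intervalIntegrable {f w : ℝ → ℝ} (h : IsL2WeakDeriv f w) :
    IntervalIntegrable w volume 0 1 := by
  rw [intervalIntegrable_iff_integrableOn_Ioo_of_le zero_le_one]
  exact h.memLp.integrable (by norm_num)

/-- A function of `H¹₀` is the primitive of its weak derivative. -/
theorem IsL2WeakDeriv.eq_integral {v : CD} {w : ℝ → ℝ} (h : IsL2WeakDeriv v.toReal w) :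
    ∀ x ∈ Icc (0 : ℝ) 1, v.toReal x = ∫ y in (0 : ℝ)..x, w y := by
  have hw := h.intervalIntegrable
  set W : ℝ → ℝ := fun x => ∫ y in (0 : ℝ)..x, w y with hW
  have hWc : ContinuousOn W (Icc 0 1) := by
    have := intervalIntegral.continuousOn_primitive_interval' hw left_mem_uIcc
    rwa [uIcc_of_le zero_le_one] at this
  have hcv : ContinuousOn v.toReal (Icc 0 1) := v.continuous_toReal.continuousOn
  -- `v` and the primitive `W` share the weak derivative `w`, so they differ by a constant, which is
  -- `0` by evaluation at `0`.
  obtain ⟨C, hC⟩ := eq_const_of_integral_mul_deriv_eq_zero (hcv.sub hWc) (by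
    intro φ hφ hφc hφt
    have hφ0 : φ 0 = 0 := image_eq_zero_of_notMem_tsupport fun h => lt_irrefl _ (hφt h).1
    have hφ1 : φ 1 = 0 := image_eq_zero_of_notMem_tsupport fun h => lt_irrefl _ (hφt h).2
    have hdc : Continuous (deriv φ) := hφ.continuous_deriv (by simp)
    have hp := integral_mul_eq_sub_of_primitive (f := W) (g := φ) (w := w) (v := deriv φ)
      zero_le_one hw (hdc.intervalIntegrable _ _) (fun x _ => by simp [hW]) (fun x _ => by
        rw [intervalIntegral.integral_deriv_eq_sub
          (fun y _ => (hφ.differentiable (by simp)).differentiableAt)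
          (hdc.intervalIntegrable _ _)]
        ring)
    simp only [hφ0, hφ1, mul_zero, sub_zero, zero_sub] at hp
    rw [intervalIntegral.integral_of_le zero_le_one, intervalIntegral.integral_of_le zero_le_one,
      integral_Ioc_eq_integral_Ioo, integral_Ioc_eq_integral_Ioo] at hp
    have i1 : IntegrableOn (fun x => v.toReal x * deriv φ x) (Ioo 0 1) := ((hcv.mul hdc.continuousOn).integrableOn_Icc (μ := volume)).mono_set
      (Ioo_subset_Icc_self (a := (0 : ℝ)) (b := 1))
    have i2 : IntegrableOn (fun x => W x * deriv φ x) (Ioo 0 1) := ((hWc.mul hdc.continuousOn).integrableOn_Icc (μ := volume)).mono_set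
      (Ioo_subset_Icc_self (a := (0 : ℝ)) (b := 1))
    have := h.weak φ hφ hφc hφt
    calc ∫ x in Ioo (0 : ℝ) 1, (v.toReal - W) x * deriv φ x
        = (∫ x in Ioo (0 : ℝ) 1, v.toReal x * deriv φ x)
          - ∫ x in Ioo (0 : ℝ) 1, W x * deriv φ x := by
          rw [← integral_sub i1 i2]
          refine integral_congr_ae (Eventually.of_forall fun x => ?_)
          simp only [Pi.sub_apply]; ring
      _ = 0 := by rw [this, hp]; ring)
  have h0 := hC 0 (left_mem_Icc.2 zero_le_one)
  simp only [Pi.sub_apply, v.toReal_zero, hW, intervalIntegral.integral_same, sub_zero] at h0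
  intro x hx
  have := hC x hx
  rw [← h0, Pi.sub_apply] at this
  linarith

/-! ### The source term and integrals over the time strip. -/

/-- The open time strip `(0,∞) × [0,1]`. -/
abbrev strip : Set (ℝ × ℝ) := Ioi (0 : ℝ) ×ˢ Icc (0 : ℝ) 1

theorem continuous_source {p : ℝ} (hp : 1 < p) : Continuous (source p) :=
  continuous_id.mul (continuous_abs.rpow_const fun _ => Or.inr (by linarith))

theorem hasDerivAt_abs_rpow_div {p : ℝ} (hp : 1 < p) (r : ℝ) :
    HasDerivAt (fun r => |r| ^ (p + 1) / (p + 1)) (source p r) r := by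
  refine ((hasDerivAt_abs_rpow r (p := p + 1) (by linarith)).div_const (p + 1)).congr_deriv ?_
  have : p + 1 ≠ 0 := by linarith
  simp only [source, show p + 1 - 2 = p - 1 by ring]
  field_simp

theorem mul_source {p : ℝ} (hp : 1 < p) (r : ℝ) : r * source p r = |r| ^ (p + 1) := by
  rcases eq_or_ne r 0 with rfl | hr
  · simp [Real.zero_rpow (show p + 1 ≠ 0 by linarith)]
  · rw [source, show p + 1 = (p - 1) + 2 by ring, Real.rpow_add (abs_pos.2 hr), Real.rpow_two,
      sq_abs]
    ring

theorem abs_source {p : ℝ} (hp : 1 < p) (r : ℝ) : |source p r| = |r| ^ p := by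
  rcases eq_or_ne r 0 with rfl | hr
  · simp [source, Real.zero_rpow (show p ≠ 0 by linarith)]
  · rw [source, abs_mul, abs_of_nonneg (Real.rpow_nonneg (abs_nonneg r) _)]
    conv_lhs => rw [← Real.rpow_one |r|]
    rw [Real.rpow_one, ← Real.rpow_one_add' (abs_nonneg r) (by linarith)]
    congr 1; ring

theorem source_neg (p r : ℝ) : source p (-r) = -source p r := by
  simp [source]

section Strip

variable {F F' : ℝ → ℝ → ℝ}

theorem continuousOn_slice (hF : ContinuousOn (Function.uncurry F) strip) {t : ℝ} (ht : 0 < t) :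
    ContinuousOn (F t) (Icc 0 1) :=
  hF.comp (f := fun x => (t, x)) (by fun_prop) fun _ hx => ⟨ht, hx⟩

theorem continuousOn_time_slice (hF : ContinuousOn (Function.uncurry F) strip) {x : ℝ}
    (hx : x ∈ Icc (0 : ℝ) 1) : ContinuousOn (fun t => F t x) (Ioi 0) :=
  hF.comp (f := fun t => (t, x)) (by fun_prop) fun _ ht => ⟨ht, hx⟩

theorem intervalIntegrable_of_continuousOn_Icc {f : ℝ → ℝ} (hf : ContinuousOn f (Icc 0 1)) :
    IntervalIntegrable f volume 0 1 :=
  ContinuousOn.intervalIntegrable (by rwa [uIcc_of_le zero_le_one])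

theorem exists_bound_strip (hF : ContinuousOn (Function.uncurry F) strip) {t : ℝ} (ht : 0 < t) :
    ∃ C, ∀ s ∈ Ioo (t / 2) (2 * t), ∀ x ∈ Icc (0 : ℝ) 1, |F s x| ≤ C := by
  have hK : IsCompact (Icc (t / 2) (2 * t) ×ˢ Icc (0 : ℝ) 1) := isCompact_Icc.prod isCompact_Icc
  obtain ⟨C, hC⟩ := hK.exists_bound_of_continuousOn (f := Function.uncurry F)
    (hF.mono (prod_mono (fun s hs => (by linarith [hs.1] : (0 : ℝ) < s).trans_le le_rfl) le_rfl))
  exact ⟨C, fun s hs x hx => hC (s, x) ⟨Ioo_subset_Icc_self hs, hx⟩⟩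

theorem Ioo_half_double_mem_nhds {t : ℝ} (ht : 0 < t) : Ioo (t / 2) (2 * t) ∈ 𝓝 t :=
  Ioo_mem_nhds (by linarith) (by linarith)

theorem aestronglyMeasurable_slice (hF : ContinuousOn (Function.uncurry F) strip) {t : ℝ}
    (ht : 0 < t) : AEStronglyMeasurable (F t) (volume.restrict (uIoc 0 1)) := by
  rw [uIoc_of_le zero_le_one]
  exact ((continuousOn_slice hF ht).mono Ioc_subset_Icc_self).aestronglyMeasurable
    measurableSet_Ioc

/-- Differentiation under the integral sign on the strip. -/
theorem hasDerivAt_integral_strip (hF : ContinuousOn (Function.uncurry F) strip)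
    (hF' : ContinuousOn (Function.uncurry F') strip)
    (hd : ∀ t, 0 < t → ∀ x ∈ Icc (0 : ℝ) 1, HasDerivAt (fun s => F s x) (F' t x) t)
    {t : ℝ} (ht : 0 < t) :
    HasDerivAt (fun s => ∫ x in (0 : ℝ)..1, F s x) (∫ x in (0 : ℝ)..1, F' t x) t := by
  obtain ⟨C, hC⟩ := exists_bound_strip hF' ht
  have hmem : ∀ x ∈ uIoc (0 : ℝ) 1, x ∈ Icc (0 : ℝ) 1 := fun x hx => by
    rw [uIoc_of_le zero_le_one] at hx; exact Ioc_subset_Icc_self hx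
  refine (intervalIntegral.hasDerivAt_integral_of_dominated_loc_of_deriv_le (bound := fun _ => C)
    (Ioo_half_double_mem_nhds ht) ?_ (intervalIntegrable_of_continuousOn_Icc
      (continuousOn_slice hF ht)) (aestronglyMeasurable_slice hF' ht) ?_ (by simp) ?_).2
  · filter_upwards [Ioi_mem_nhds ht] with s hs using aestronglyMeasurable_slice hF hs
  · exact Eventually.of_forall fun x hx s hs => hC s hs x (hmem x hx)
  · exact Eventually.of_forall fun x hx s hs => hd s (by linarith [hs.1]) x (hmem x hx)

end Strip

/-- Integration by parts against a function vanishing at the boundary. -/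
theorem integral_mul_deriv_of_boundary {f f' k k' : ℝ → ℝ}
    (hf : ∀ x ∈ Icc (0 : ℝ) 1, HasDerivWithinAt f (f' x) (Icc 0 1) x)
    (hk : ∀ x ∈ Icc (0 : ℝ) 1, HasDerivWithinAt k (k' x) (Icc 0 1) x)
    (hf' : ContinuousOn f' (Icc 0 1)) (hk' : ContinuousOn k' (Icc 0 1))
    (h0 : f 0 = 0) (h1 : f 1 = 0) :
    ∫ x in (0 : ℝ)..1, f x * k' x = -∫ x in (0 : ℝ)..1, f' x * k x := by
  have := intervalIntegral.integral_mul_deriv_eq_deriv_mul_of_hasDerivWithinAt (a := 0) (b := 1)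
    (u := f) (v := k) (u' := f') (v' := k') (by rwa [uIcc_of_le zero_le_one])
    (by rwa [uIcc_of_le zero_le_one]) (intervalIntegrable_of_continuousOn_Icc hf')
    (intervalIntegrable_of_continuousOn_Icc hk')
  rw [this, h0, h1]; ring

/-! ### Energy identities for classical solutions. -/

/-- Classical solutions of the equation for positive times, with named space derivatives. -/
structure IsClassical (p : ℝ) (U Ux Uxx : ℝ → ℝ → ℝ) : Prop where
  cont : ContinuousOn (Function.uncurry U) strip
  cont_x : ContinuousOn (Function.uncurry Ux) strip
  cont_xx : ContinuousOn (Function.uncurry Uxx) strip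
  left : ∀ t, 0 < t → U t 0 = 0
  right : ∀ t, 0 < t → U t 1 = 0
  deriv_x : ∀ t, 0 < t → ∀ x ∈ Icc (0 : ℝ) 1, HasDerivWithinAt (U t) (Ux t x) (Icc 0 1) x
  deriv_xx : ∀ t, 0 < t → ∀ x ∈ Icc (0 : ℝ) 1, HasDerivWithinAt (Ux t) (Uxx t x) (Icc 0 1) x
  deriv_t : ∀ t, 0 < t → ∀ x ∈ Icc (0 : ℝ) 1,
    HasDerivAt (fun s => U s x) (Uxx t x + source p (U t x)) t

theorem IsGlobalSolution.exists_isClassical {p : ℝ} {u : CD} {U : ℝ → ℝ → ℝ}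
    (h : IsGlobalSolution p u U) : ∃ Ux Uxx, IsClassical p U Ux Uxx := by
  obtain ⟨Ux, Uxx, h1, h2, h3⟩ := h.equation
  exact ⟨Ux, Uxx, h.continuousOn.mono (prod_mono Ioi_subset_Ici_self le_rfl), h1, h2,
    fun t ht => h.left_boundary t ht.le, fun t ht => h.right_boundary t ht.le,
    fun t ht x hx => (h3 t ht x hx).1, fun t ht x hx => (h3 t ht x hx).2.1,
    fun t ht x hx => (h3 t ht x hx).2.2⟩

namespace IsClassical

variable {p : ℝ} {U Ux Uxx : ℝ → ℝ → ℝ}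

theorem cont_source (h : IsClassical p U Ux Uxx) (hp : 1 < p) :
    ContinuousOn (Function.uncurry fun t x => source p (U t x)) strip :=
  (continuous_source hp).comp_continuousOn h.cont

theorem cont_t (h : IsClassical p U Ux Uxx) (hp : 1 < p) :
    ContinuousOn (Function.uncurry fun t x => Uxx t x + source p (U t x)) strip :=
  h.cont_xx.add (h.cont_source hp)

theorem integral_deriv_mul_deriv (h : IsClassical p U Ux Uxx) {s t : ℝ} (hs : 0 < s)
    (ht : 0 < t) :
    ∫ x in (0 : ℝ)..1, Ux s x * Ux t x = -∫ x in (0 : ℝ)..1, U s x * Uxx t x := by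
  rw [integral_mul_deriv_of_boundary (h.deriv_x s hs) (h.deriv_xx t ht)
    (continuousOn_slice h.cont_x hs) (continuousOn_slice h.cont_xx ht) (h.left s hs)
    (h.right s hs), neg_neg]

/-- The factorisation `a² - b² = (a - b)(a + b)` and integration by parts. It turns time increments
of `U_x` into increments of `U`, so that the Dirichlet integral can be differentiated without a
mixed derivative of `U`. -/
theorem integral_sq_deriv_sub (h : IsClassical p U Ux Uxx) {s t : ℝ} (hs : 0 < s)
    (ht : 0 < t) :
    (∫ x in (0 : ℝ)..1, Ux s x ^ 2) - ∫ x in (0 : ℝ)..1, Ux t x ^ 2 =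
      -∫ x in (0 : ℝ)..1, (U s x - U t x) * (Uxx s x + Uxx t x) := by
  have c {r : ℝ} (hr : 0 < r) := continuousOn_slice h.cont hr
  have cx {r : ℝ} (hr : 0 < r) := continuousOn_slice h.cont_xx hr
  have i {r q : ℝ} (hr : 0 < r) (hq : 0 < q) :
      IntervalIntegrable (fun x => U r x * Uxx q x) volume 0 1 :=
    intervalIntegrable_of_continuousOn_Icc ((c hr).mul (cx hq))
  have e : ∫ x in (0 : ℝ)..1, (U s x - U t x) * (Uxx s x + Uxx t x) =
      ((∫ x in (0 : ℝ)..1, U s x * Uxx s x) + ∫ x in (0 : ℝ)..1, U s x * Uxx t x) -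
      ((∫ x in (0 : ℝ)..1, U t x * Uxx s x) + ∫ x in (0 : ℝ)..1, U t x * Uxx t x) := by
    rw [← intervalIntegral.integral_add (i hs hs) (i hs ht),
      ← intervalIntegral.integral_add (i ht hs) (i ht ht),
      ← intervalIntegral.integral_sub ((i hs hs).add (i hs ht)) ((i ht hs).add (i ht ht))]
    congr 1; ext x; ring
  have h1 := h.integral_deriv_mul_deriv hs hs
  have h2 := h.integral_deriv_mul_deriv hs ht
  have h3 := h.integral_deriv_mul_deriv ht hs
  have h4 := h.integral_deriv_mul_deriv ht ht
  have h5 : ∫ x in (0 : ℝ)..1, Ux s x * Ux t x = ∫ x in (0 : ℝ)..1, Ux t x * Ux s x := by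
    simp only [mul_comm]
  simp only [pow_two]
  linarith

/-- The Dirichlet integral is differentiable in time. -/
theorem hasDerivAt_integral_sq_deriv (h : IsClassical p U Ux Uxx) (hp : 1 < p) {t : ℝ}
    (ht : 0 < t) :
    HasDerivAt (fun s => ∫ x in (0 : ℝ)..1, Ux s x ^ 2)
      (-∫ x in (0 : ℝ)..1, (Uxx t x + source p (U t x)) * (2 * Uxx t x)) t := by
  obtain ⟨C, hC⟩ := exists_bound_strip (h.cont_t hp) ht
  obtain ⟨D, hD⟩ := exists_bound_strip h.cont_xx ht
  have hmem : ∀ x ∈ uIoc (0 : ℝ) 1, x ∈ Icc (0 : ℝ) 1 := fun x hx => by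
    rw [uIoc_of_le zero_le_one] at hx; exact Ioc_subset_Icc_self hx
  have hnb := Ioo_half_double_mem_nhds ht
  have htm : t ∈ Ioo (t / 2) (2 * t) := ⟨by linarith, by linarith⟩
  rw [hasDerivAt_iff_tendsto_slope]
  have hlim : Tendsto (fun s => ∫ x in (0 : ℝ)..1,
      slope (fun r => U r x) t s * (Uxx s x + Uxx t x)) (𝓝[≠] t)
      (𝓝 (∫ x in (0 : ℝ)..1, (Uxx t x + source p (U t x)) * (2 * Uxx t x))) := by
    refine intervalIntegral.tendsto_integral_filter_of_dominated_convergence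
      (fun _ => C * (D + D)) ?_ ?_ (by simp) ?_
    · filter_upwards [nhdsWithin_le_nhds (Ioi_mem_nhds ht)] with s hs
      simp only [slope_def_field]
      exact (((aestronglyMeasurable_slice h.cont hs).sub
        (aestronglyMeasurable_slice h.cont ht)).mul
        (aestronglyMeasurable_const (b := (s - t)⁻¹))).mul
        ((aestronglyMeasurable_slice h.cont_xx hs).add (aestronglyMeasurable_slice h.cont_xx ht))
    · filter_upwards [nhdsWithin_le_nhds hnb, self_mem_nhdsWithin] with s hs hne
      refine Eventually.of_forall fun x hx => ?_
      have hx' := hmem x hx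
      -- The mean value inequality dominates the difference quotients in time by the local bound `C`
      -- on the time derivative.
      have hmv := (convex_Ioo (t / 2) (2 * t)).norm_image_sub_le_of_norm_hasDerivWithin_le
        (f := fun r => U r x) (f' := fun r => Uxx r x + source p (U r x)) (C := C)
        (fun r hr => (h.deriv_t r (by linarith [hr.1]) x hx').hasDerivWithinAt)
        (fun r hr => hC r hr x hx') htm hs
      have hpos : 0 < |s - t| := abs_pos.2 (sub_ne_zero.2 hne)
      rw [norm_mul, slope_def_field, norm_div]
      refine mul_le_mul ?_ ?_ (norm_nonneg _) ((abs_nonneg _).trans (hC t htm x hx'))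
      · exact div_le_of_le_mul₀ hpos.le ((abs_nonneg _).trans (hC t htm x hx')) hmv
      · exact (norm_add_le _ _).trans (add_le_add (hD s hs x hx') (hD t htm x hx'))
    · refine Eventually.of_forall fun x hx => ?_
      have hx' := hmem x hx
      refine Tendsto.mul (hasDerivAt_iff_tendsto_slope.1 (h.deriv_t t ht x hx')) ?_
      have hc : Tendsto (fun s => Uxx s x) (𝓝[≠] t) (𝓝 (Uxx t x)) :=
        ((continuousOn_time_slice h.cont_xx hx').continuousAt (Ioi_mem_nhds ht)).tendsto.mono_left
          nhdsWithin_le_nhds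
      rw [two_mul]
      exact hc.add tendsto_const_nhds
  refine hlim.neg.congr' ?_
  filter_upwards [nhdsWithin_le_nhds (Ioi_mem_nhds ht)] with s hs
  rw [slope_def_field, h.integral_sq_deriv_sub hs ht, neg_div, ← intervalIntegral.integral_div]
  congr 2; ext x
  rw [slope_def_field]; ring

/-- The energy of a solution. -/
def energy (p : ℝ) (U Ux : ℝ → ℝ → ℝ) (t : ℝ) : ℝ :=
  (1 / 2) * (∫ x in (0 : ℝ)..1, Ux t x ^ 2) - ∫ x in (0 : ℝ)..1, |U t x| ^ (p + 1) / (p + 1)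

theorem cont_abs_rpow (h : IsClassical p U Ux Uxx) (hp : 1 < p) :
    ContinuousOn (Function.uncurry fun t x => |U t x| ^ (p + 1)) strip :=
  (continuous_abs.rpow_const (p := p + 1) fun _ => Or.inr (by linarith)).comp_continuousOn h.cont

/-- Gradient flow structure: the two contributions `-∫ U_t U_xx` and `-∫ U_t g(U)` add up to `-∫
U_t²`. -/
theorem hasDerivAt_energy (h : IsClassical p U Ux Uxx) (hp : 1 < p) {t : ℝ} (ht : 0 < t) :
    HasDerivAt (energy p U Ux) (-∫ x in (0 : ℝ)..1, (Uxx t x + source p (U t x)) ^ 2) t := by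
  have h1 := (h.hasDerivAt_integral_sq_deriv hp ht).const_mul (1 / 2)
  have h2 := hasDerivAt_integral_strip
    (F := fun t x => |U t x| ^ (p + 1) / (p + 1))
    (F' := fun t x => source p (U t x) * (Uxx t x + source p (U t x)))
    ((h.cont_abs_rpow hp).div_const _) ((h.cont_source hp).mul (h.cont_t hp))
    (fun s hs x hx => HasDerivAt.comp (h₂ := fun r => |r| ^ (p + 1) / (p + 1)) s
      (hasDerivAt_abs_rpow_div hp (U s x)) (h.deriv_t s hs x hx)) ht
  have ct := continuousOn_slice (h.cont_t hp) ht
  have cx := continuousOn_slice h.cont_xx ht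
  have cs := continuousOn_slice (h.cont_source hp) ht
  refine (h1.sub h2).congr_deriv ?_
  symm
  rw [mul_neg, ← intervalIntegral.integral_const_mul, ← neg_add', ← intervalIntegral.integral_add]
  · congr 2; ext x; ring
  · exact intervalIntegrable_of_continuousOn_Icc
      (continuousOn_const.mul (ct.mul (continuousOn_const.mul cx)))
  · exact intervalIntegrable_of_continuousOn_Icc (cs.mul ct)

theorem energy_antitoneOn (h : IsClassical p U Ux Uxx) (hp : 1 < p) :
    AntitoneOn (energy p U Ux) (Ioi 0) := by
  refine antitoneOn_of_deriv_nonpos (convex_Ioi 0)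
    (fun t ht => (h.hasDerivAt_energy hp ht).continuousAt.continuousWithinAt)
    (fun t ht => ?_) (fun t ht => ?_) <;> rw [interior_Ioi] at ht
  · exact (h.hasDerivAt_energy hp ht).differentiableAt.differentiableWithinAt
  · rw [(h.hasDerivAt_energy hp ht).deriv, neg_nonpos]
    exact intervalIntegral.integral_nonneg zero_le_one fun x _ => sq_nonneg _

/-- Testing the equation with `2U` gives `-2 ∫ U_x² + 2 ∫ |U|^(p+1)`. The Dirichlet integral is then
eliminated through the energy, leaving the positive coefficient `2 - 4/(p+1)`. -/
theorem hasDerivAt_integral_sq (h : IsClassical p U Ux Uxx) (hp : 1 < p) {t : ℝ} (ht : 0 < t) :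
    HasDerivAt (fun s => ∫ x in (0 : ℝ)..1, U s x ^ 2)
      (-4 * energy p U Ux t +
        2 * ((p - 1) / (p + 1)) * ∫ x in (0 : ℝ)..1, |U t x| ^ (p + 1)) t := by
  have hsq : ContinuousOn (Function.uncurry fun t x => U t x ^ 2) strip := h.cont.pow 2
  have h1 := hasDerivAt_integral_strip (F := fun t x => U t x ^ 2)
    (F' := fun t x => 2 * U t x * (Uxx t x + source p (U t x)))
    hsq (((continuousOn_const (c := (2 : ℝ))).mul h.cont).mul (h.cont_t hp))
    (fun s hs x hx => by simpa using (h.deriv_t s hs x hx).fun_pow 2) ht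
  refine h1.congr_deriv ?_
  have cx := continuousOn_slice h.cont_xx ht
  have cU := continuousOn_slice h.cont ht
  have cp := continuousOn_slice (h.cont_abs_rpow hp) ht
  have e1 : ∫ x in (0 : ℝ)..1, 2 * U t x * (Uxx t x + source p (U t x)) =
      2 * (∫ x in (0 : ℝ)..1, U t x * Uxx t x) + 2 * ∫ x in (0 : ℝ)..1, |U t x| ^ (p + 1) := by
    rw [← intervalIntegral.integral_const_mul, ← intervalIntegral.integral_const_mul,
      ← intervalIntegral.integral_add]
    · congr 1; ext x; rw [← mul_source hp]; ring
    · exact intervalIntegrable_of_continuousOn_Icc (continuousOn_const.mul (cU.mul cx))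
    · exact intervalIntegrable_of_continuousOn_Icc (continuousOn_const.mul cp)
  have e2 := h.integral_deriv_mul_deriv ht ht
  have e3 : ∫ x in (0 : ℝ)..1, |U t x| ^ (p + 1) / (p + 1) =
    (∫ x in (0 : ℝ)..1, |U t x| ^ (p + 1)) / (p + 1) := intervalIntegral.integral_div _ _
  simp only [← pow_two] at e2
  rw [e1, energy, e2, e3]
  have : p + 1 ≠ 0 := by linarith
  field_simp
  ring

end IsClassical

/-! ### Finite-time blow-up and the `L²` bound for global solutions. -/

/-- Jensen's inequality for powers of the square. -/
theorem integral_sq_rpow_le {f : ℝ → ℝ} {q : ℝ} (hq : 1 ≤ q) (hf : ContinuousOn f (Icc 0 1)) :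
    (∫ x in (0 : ℝ)..1, f x ^ 2) ^ q ≤ ∫ x in (0 : ℝ)..1, |f x| ^ (2 * q) := by
  have hprob : IsProbabilityMeasure (volume.restrict (Ioc (0 : ℝ) 1)) := ⟨by simp⟩
  have hi : ∀ g : ℝ → ℝ, ContinuousOn g (Icc 0 1) →
      Integrable g (volume.restrict (Ioc (0 : ℝ) 1)) := fun g hg =>
    (hg.integrableOn_Icc (μ := volume)).mono_set Ioc_subset_Icc_self
  have he : ∀ x, (f x ^ 2) ^ q = |f x| ^ (2 * q) := fun x => by
    rw [← sq_abs, ← Real.rpow_natCast, ← Real.rpow_mul (abs_nonneg _)]; norm_num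
  rw [intervalIntegral.integral_of_le zero_le_one, intervalIntegral.integral_of_le zero_le_one]
  have := (convexOn_rpow hq).map_integral_le (μ := volume.restrict (Ioc (0 : ℝ) 1))
    (f := fun x => f x ^ 2)
    (continuousOn_id.rpow_const fun _ _ => Or.inr (by linarith)) isClosed_Ici
    (Eventually.of_forall fun x => sq_nonneg (f x)) (hi _ (hf.pow 2))
    (hi _ ((hf.pow 2).rpow_const fun _ _ => Or.inr (by linarith)))
  simpa only [Function.comp_def, he] using this

/-- A function with `y' ≥ c y ^ q`, `q > 1`, above a level `Y > 0` cannot start above that level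
and exist for all times. -/
theorem le_of_rpow_le_deriv {y y' : ℝ → ℝ} {t₀ c q Y : ℝ} (hc : 0 < c) (hq : 1 < q) (hY : 0 < Y)
    (hd : ∀ t, t₀ ≤ t → HasDerivAt y (y' t) t)
    (hb : ∀ t, t₀ ≤ t → Y ≤ y t → c * y t ^ q ≤ y' t) : y t₀ ≤ Y := by
  by_contra! hlt
  have hpos : ∀ t, t₀ ≤ t → Y ≤ y t := by
    intro T hT
    -- The level `Y` is a barrier: wherever `y = Y` the derivative is positive, so `y` cannot cross
    -- it downwards.
    have := image_le_of_deriv_right_lt_deriv_boundary (f := fun t => -y t) (f' := fun t => -y' t)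
      (a := t₀) (b := T) (B := fun _ => -Y) (B' := fun _ => 0)
      (fun t ht => (hd t ht.1).continuousAt.continuousWithinAt.neg)
      (fun t ht => (hd t ht.1).neg.hasDerivWithinAt) (by simpa using hlt.le)
      (fun t => hasDerivAt_const _ _) (fun t ht he => by
        have he' : y t = Y := by simpa using he
        have := hb t ht.1 he'.ge
        have h2 : 0 < c * y t ^ q := mul_pos hc (Real.rpow_pos_of_pos (he' ▸ hY) _)
        linarith) (right_mem_Icc.2 hT)
    simpa using this
  -- Separation of variables: `y' ≥ c y^q` makes `y^(1-q)` decrease at rate at least `(q-1)c`.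
  have hzd : ∀ t, t₀ ≤ t → HasDerivAt (fun t => y t ^ (1 - q) + (q - 1) * c * t)
      (y' t * (1 - q) * y t ^ (1 - q - 1) + (q - 1) * c * 1) t := fun t ht =>
    ((hd t ht).rpow_const (Or.inl (hY.trans_le (hpos t ht)).ne')).add
      ((hasDerivAt_id t).const_mul _)
  have hanti : AntitoneOn (fun t => y t ^ (1 - q) + (q - 1) * c * t) (Ici t₀) := by
    refine antitoneOn_of_deriv_nonpos (convex_Ici t₀)
      (fun t ht => (hzd t ht).continuousAt.continuousWithinAt)
      (fun t ht => ?_) (fun t ht => ?_) <;> rw [interior_Ici] at ht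
    · exact (hzd t (le_of_lt ht)).differentiableAt.differentiableWithinAt
    · rw [(hzd t (le_of_lt ht)).deriv]
      have hyt := hY.trans_le (hpos t (le_of_lt ht))
      have h1 := hb t (le_of_lt ht) (hpos t (le_of_lt ht))
      have h2 : 0 < y t ^ (-q) := Real.rpow_pos_of_pos hyt _
      have h3 : y t ^ q * y t ^ (-q) = 1 := by rw [← Real.rpow_add hyt]; simp
      have h4 : c * (y t ^ q * y t ^ (-q)) ≤ y' t * y t ^ (-q) := by
        rw [← mul_assoc]; exact mul_le_mul_of_nonneg_right h1 h2.le
      rw [h3] at h4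
      rw [show 1 - q - 1 = -q by ring]
      nlinarith
  -- By this time the linear decrease has used up `y(t₀)^(1-q)`, which contradicts `y(T)^(1-q) > 0`.
  set T := t₀ + y t₀ ^ (1 - q) / ((q - 1) * c) with hT
  have hqc : 0 < (q - 1) * c := mul_pos (by linarith) hc
  have hTge : t₀ ≤ T := by
    have : 0 ≤ y t₀ ^ (1 - q) / ((q - 1) * c) :=
      div_nonneg (Real.rpow_nonneg (hY.trans hlt).le _) hqc.le
    linarith
  have := hanti self_mem_Ici hTge hTge
  simp only at this
  have h5 : 0 < y T ^ (1 - q) := Real.rpow_pos_of_pos (hY.trans_le (hpos T hTge)) _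
  have h6 : (q - 1) * c * T = (q - 1) * c * t₀ + y t₀ ^ (1 - q) := by
    rw [hT, mul_add, mul_div_cancel₀ _ hqc.ne']
  linarith

/-- A bound for the `L²` norm of global solutions in terms of their energy. -/
theorem exists_integral_sq_le {p : ℝ} (hp : 1 < p) (b : ℝ) :
    ∃ Y : ℝ, 0 < Y ∧ ∀ U Ux Uxx : ℝ → ℝ → ℝ, IsClassical p U Ux Uxx → ∀ t, 0 < t →
      IsClassical.energy p U Ux t ≤ b → ∫ x in (0 : ℝ)..1, U t x ^ 2 ≤ Y := by
  set c := (p - 1) / (p + 1) with hcd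
  set q := (p + 1) / 2 with hqd
  have hc : 0 < c := div_pos (by linarith) (by linarith)
  have hq : 1 < q := by rw [hqd]; linarith
  -- `Y` is chosen so that `4b ≤ c Y^q`. Above this level half of the term `2c y^q` absorbs the
  -- energy, leaving `y' ≥ c y^q`. The `+ 1` keeps `Y` positive.
  set Y := (4 * |b| / c) ^ (1 / q) + 1 with hYd
  have hb0 : 0 ≤ 4 * |b| / c := by positivity
  have hY : 0 < Y := by have := Real.rpow_nonneg hb0 (1 / q); linarith
  have hYq : 4 * b ≤ c * Y ^ q := by
    have h1 : 4 * |b| / c ≤ Y ^ q := by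
      calc 4 * |b| / c = ((4 * |b| / c) ^ (1 / q)) ^ q := by
            rw [← Real.rpow_mul hb0, one_div_mul_cancel (by linarith), Real.rpow_one]
        _ ≤ Y ^ q := Real.rpow_le_rpow (Real.rpow_nonneg hb0 _) (by linarith) (by linarith)
    rw [div_le_iff₀ hc] at h1
    nlinarith [le_abs_self b]
  refine ⟨Y, hY, fun U Ux Uxx h t₀ ht₀ hE => ?_⟩
  refine le_of_rpow_le_deriv (y := fun t => ∫ x in (0 : ℝ)..1, U t x ^ 2) hc hq hY
    (fun t ht => h.hasDerivAt_integral_sq hp (ht₀.trans_le ht)) fun t ht hyt => ?_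
  have hEt := h.energy_antitoneOn hp ht₀ (ht₀.trans_le ht) ht
  have hJ := integral_sq_rpow_le hq.le (continuousOn_slice h.cont (ht₀.trans_le ht))
  rw [show 2 * q = p + 1 by rw [hqd]; ring] at hJ
  have hm : Y ^ q ≤ (∫ x in (0 : ℝ)..1, U t x ^ 2) ^ q :=
    Real.rpow_le_rpow hY.le hyt (by linarith)
  nlinarith

/-! ### Maximum principle and short-time sup bounds. -/

/-- The second derivative is nonpositive at an interior maximum point. -/
theorem second_deriv_nonpos_of_max {f f' : ℝ → ℝ} {f'' x₀ : ℝ} (hx₀ : x₀ ∈ Ioo (0 : ℝ) 1)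
    (hf : ∀ x ∈ Icc (0 : ℝ) 1, HasDerivWithinAt f (f' x) (Icc 0 1) x)
    (hf' : HasDerivWithinAt f' f'' (Icc 0 1) x₀) (hmax : ∀ x ∈ Icc (0 : ℝ) 1, f x ≤ f x₀) :
    f'' ≤ 0 := by
  by_contra! hpos
  have hnb : Icc (0 : ℝ) 1 ∈ 𝓝 x₀ := Icc_mem_nhds hx₀.1 hx₀.2
  have hloc : IsLocalMax f x₀ := by filter_upwards [hnb] with x hx using hmax x hx
  have hdf : deriv f =ᶠ[𝓝 x₀] f' := by
    filter_upwards [Ioo_mem_nhds hx₀.1 hx₀.2] with x hx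
    exact ((hf x (Ioo_subset_Icc_self hx)).hasDerivAt (Icc_mem_nhds hx.1 hx.2)).deriv
  have hddf : deriv (deriv f) x₀ = f'' := by
    rw [hdf.deriv_eq, (hf'.hasDerivAt hnb).deriv]
  -- If `f'' > 0`, the maximum point would also be a local minimum, so `f` would be locally constant
  -- and `f'' = 0`.
  have hmin : IsLocalMin f x₀ := isLocalMin_of_deriv_deriv_pos (hddf ▸ hpos) hloc.deriv_eq_zero
    ((hf x₀ (Ioo_subset_Icc_self hx₀)).hasDerivAt hnb).continuousAt
  have hconst : f =ᶠ[𝓝 x₀] fun _ => f x₀ := by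
    filter_upwards [hloc, hmin] with x h1 h2 using le_antisymm h1 h2
  have : deriv (deriv f) x₀ = 0 := by
    rw [hconst.deriv.deriv_eq]; simp
  linarith

/-- As `g` is odd, this reflection turns upper bounds for solutions into two-sided ones. -/
theorem IsClassical.neg {p : ℝ} {U Ux Uxx : ℝ → ℝ → ℝ} (h : IsClassical p U Ux Uxx) :
    IsClassical p (fun t x => -U t x) (fun t x => -Ux t x) (fun t x => -Uxx t x) where
  cont := h.cont.neg
  cont_x := h.cont_x.neg
  cont_xx := h.cont_xx.neg
  left t ht := by simp [h.left t ht]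
  right t ht := by simp [h.right t ht]
  deriv_x t ht x hx := (h.deriv_x t ht x hx).fun_neg
  deriv_xx t ht x hx := (h.deriv_xx t ht x hx).fun_neg
  deriv_t t ht x hx := (h.deriv_t t ht x hx).fun_neg.congr_deriv (by rw [source_neg]; ring)

/-- A short-time upper bound, by comparison with a linearly growing supersolution. -/
theorem IsClassical.le_of_initial_le {p : ℝ} {U Ux Uxx : ℝ → ℝ → ℝ} (h : IsClassical p U Ux Uxx)
    (hp : 1 < p) (hc : ContinuousOn (Function.uncurry U) (Ici (0 : ℝ) ×ˢ Icc (0 : ℝ) 1))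
    {A : ℝ} (hA : 0 ≤ A) (h0 : ∀ x ∈ Icc (0 : ℝ) 1, U 0 x ≤ A) :
    ∀ t ∈ Icc (0 : ℝ) (1 / (2 * ((A + 1) ^ p + 1))), ∀ x ∈ Icc (0 : ℝ) 1, U t x ≤ A + 1 := by
  -- The barrier is `A + 1/2 + L t`. Its slope exceeds the source on `[0, A + 1]` by `1`, and `L δ =
  -- 1/2` keeps it below `A + 1` up to time `δ`.
  set L := (A + 1) ^ p + 1 with hL
  set δ := 1 / (2 * L) with hδ
  have hLpos : 0 < L := by have := Real.rpow_nonneg (show 0 ≤ A + 1 by linarith) p; linarith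
  have hLδ : L * δ = 1 / 2 := by rw [hδ]; field_simp
  set Z : Set (ℝ × ℝ) := {z ∈ Icc (0 : ℝ) δ ×ˢ Icc (0 : ℝ) 1 |
    A + 1 / 2 + L * z.1 ≤ Function.uncurry U z} with hZ
  have hle : ∀ t ∈ Icc (0 : ℝ) δ, A + 1 / 2 + L * t ≤ A + 1 := fun t ht => by
    have := mul_le_mul_of_nonneg_left ht.2 hLpos.le
    linarith
  suffices hem : Z = ∅ by
    intro t ht x hx
    by_contra! hcon
    have : (t, x) ∈ Z := ⟨⟨ht, hx⟩, (hle t ht).trans hcon.le⟩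
    rw [hem] at this
    exact this
  by_contra hne
  have hKc : IsCompact (Icc (0 : ℝ) δ ×ˢ Icc (0 : ℝ) 1) := isCompact_Icc.prod isCompact_Icc
  have hUc : ContinuousOn (Function.uncurry U) (Icc (0 : ℝ) δ ×ˢ Icc (0 : ℝ) 1) :=
    hc.mono (prod_mono Icc_subset_Ici_self le_rfl)
  have hZc : IsCompact Z := by
    refine hKc.of_isClosed_subset ?_ (fun z hz => hz.1)
    exact hKc.isClosed.isClosed_le (by fun_prop) hUc
  -- The earliest contact with the barrier. There `U t₀` has an interior spatial maximum, so `U_t ≤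
  -- (A + 1)^p < L`, while reaching the barrier from below forces `U_t ≥ L`.
  obtain ⟨⟨t₀, x₀⟩, hz₀, hmin⟩ := hZc.exists_isMinOn (nonempty_iff_ne_empty.2 hne)
    (continuous_fst.continuousOn)
  obtain ⟨⟨ht₀, hx₀⟩, hge⟩ := hz₀
  simp only at ht₀ hx₀ hge
  have hge' : A + 1 / 2 + L * t₀ ≤ U t₀ x₀ := hge
  have htpos : 0 < t₀ := by
    rcases ht₀.1.eq_or_lt with h1 | h1
    · rw [← h1] at hge'
      linarith [h0 x₀ hx₀]
    · exact h1
  have hLt : 0 < L * t₀ := mul_pos hLpos htpos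
  have hbefore : ∀ t ∈ Ico (0 : ℝ) t₀, ∀ x ∈ Icc (0 : ℝ) 1, U t x < A + 1 / 2 + L * t := by
    intro t ht x hx
    by_contra! hcon
    have : (t, x) ∈ Z := ⟨⟨⟨ht.1, ht.2.le.trans ht₀.2⟩, hx⟩, hcon⟩
    exact absurd (hmin this) (not_le.2 ht.2)
  have hat : ∀ x ∈ Icc (0 : ℝ) 1, U t₀ x ≤ A + 1 / 2 + L * t₀ := by
    intro x hx
    have hcont : ContinuousAt (fun t => U t x) t₀ :=
      (h.deriv_t t₀ htpos x hx).continuousAt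
    refine le_of_tendsto_of_tendsto (b := 𝓝[<] t₀) (hcont.tendsto.mono_left nhdsWithin_le_nhds)
      (((by fun_prop : Continuous fun t => A + 1 / 2 + L * t).tendsto t₀).mono_left
        nhdsWithin_le_nhds) ?_
    filter_upwards [Ioo_mem_nhdsLT htpos] with t ht
    exact (hbefore t ⟨ht.1.le, ht.2⟩ x hx).le
  have heq : U t₀ x₀ = A + 1 / 2 + L * t₀ := le_antisymm (hat x₀ hx₀) hge'
  have hx₀' : x₀ ∈ Ioo (0 : ℝ) 1 := by
    refine ⟨lt_of_le_of_ne hx₀.1 fun h1 => ?_, lt_of_le_of_ne hx₀.2 fun h1 => ?_⟩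
    · rw [← h1, h.left t₀ htpos] at heq; linarith
    · rw [h1, h.right t₀ htpos] at heq; linarith
  have hxx : Uxx t₀ x₀ ≤ 0 := second_deriv_nonpos_of_max hx₀' (h.deriv_x t₀ htpos)
    (h.deriv_xx t₀ htpos x₀ hx₀) fun x hx => heq ▸ hat x hx
  have hsrc : source p (U t₀ x₀) ≤ (A + 1) ^ p := by
    refine (le_abs_self _).trans ?_
    rw [abs_source hp]
    have h1 : 0 ≤ U t₀ x₀ := by rw [heq]; linarith
    exact Real.rpow_le_rpow (abs_nonneg _) (by rw [abs_of_nonneg h1, heq]; exact hle t₀ ht₀)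
      (by linarith)
  have hder : L ≤ Uxx t₀ x₀ + source p (U t₀ x₀) := by
    have hsl := hasDerivAt_iff_tendsto_slope.1 (h.deriv_t t₀ htpos x₀ hx₀)
    have hsl' := hsl.mono_left (nhdsWithin_mono t₀ (fun t (ht : t ∈ Iio t₀) => ne_of_lt ht))
    refine ge_of_tendsto hsl' ?_
    filter_upwards [Ioo_mem_nhdsLT htpos] with t ht
    rw [slope_def_field, le_div_iff_of_neg (by linarith [ht.2]), heq]
    linarith [hbefore t ⟨ht.1.le, ht.2⟩ x₀ hx₀]
  linarith

/-- A short-time bound for the absolute value of solutions. -/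
theorem IsGlobalSolution.abs_le_of_initial_le {p : ℝ} {u : CD} {U : ℝ → ℝ → ℝ}
    (h : IsGlobalSolution p u U) (hp : 1 < p) {A : ℝ} (hA : 0 ≤ A)
    (h0 : ∀ x : unitInterval, |u.1 x| ≤ A) :
    ∀ t ∈ Icc (0 : ℝ) (1 / (2 * ((A + 1) ^ p + 1))), ∀ x ∈ Icc (0 : ℝ) 1, |U t x| ≤ A + 1 := by
  obtain ⟨Ux, Uxx, hcl⟩ := h.exists_isClassical
  intro t ht x hx
  have hi : ∀ x ∈ Icc (0 : ℝ) 1, |U 0 x| ≤ A := fun x hx => by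
    rw [h.initial ⟨x, hx⟩]; exact h0 _
  refine abs_le.2 ⟨?_, ?_⟩
  · have := hcl.neg.le_of_initial_le hp h.continuousOn.neg hA
      (fun x hx => (neg_le_abs _).trans (hi x hx)) t ht x hx
    linarith
  · exact hcl.le_of_initial_le hp h.continuousOn hA
      (fun x hx => (le_abs_self _).trans (hi x hx)) t ht x hx

/-! ### Energy of solutions starting near an `H¹₀` function. -/

/-- Integration by parts of an `H¹₀` function against the second derivative of a `C²` function. -/
theorem IsL2WeakDeriv.integral_mul_deriv {v : CD} {w k k' : ℝ → ℝ}
    (hw : IsL2WeakDeriv v.toReal w)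
    (hk : ∀ x ∈ Icc (0 : ℝ) 1, HasDerivWithinAt k (k' x) (Icc 0 1) x)
    (hk' : ContinuousOn k' (Icc 0 1)) :
    ∫ x in (0 : ℝ)..1, v.toReal x * k' x = -∫ x in (0 : ℝ)..1, w x * k x := by
  have := integral_mul_eq_sub_of_primitive (f := v.toReal) (g := k) (w := w) (v := k')
    zero_le_one hw.intervalIntegrable (intervalIntegrable_of_continuousOn_Icc hk')
    (fun x hx => by rw [v.toReal_zero, zero_add]; exact hw.eq_integral x hx) (fun x hx => by
      have hsub : Icc (0 : ℝ) x ⊆ Icc 0 1 := Icc_subset_Icc_right hx.2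
      rw [intervalIntegral.integral_eq_sub_of_hasDerivAt_of_le hx.1
        (f := k) (fun y hy => ((hk y (hsub hy)).mono hsub).continuousWithinAt)
        (fun y hy => (hk y (hsub (Ioo_subset_Icc_self hy))).hasDerivAt
          (Icc_mem_nhds hy.1 (hy.2.trans_le hx.2)))
        ((hk'.mono hsub).intervalIntegrable_of_Icc hx.1)]
      ring)
  rw [this, v.toReal_zero, v.toReal_one]; ring

/-- The squared `L²` distance of a solution to a fixed `H¹₀` function. -/
theorem IsClassical.hasDerivAt_integral_sq_sub {p : ℝ} {U Ux Uxx : ℝ → ℝ → ℝ}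
    (h : IsClassical p U Ux Uxx) (hp : 1 < p) {v : CD} {w : ℝ → ℝ}
    (hw : IsL2WeakDeriv v.toReal w) {t : ℝ} (ht : 0 < t) :
    HasDerivAt (fun s => ∫ x in (0 : ℝ)..1, (U s x - v.toReal x) ^ 2)
      (-2 * (∫ x in (0 : ℝ)..1, Ux t x ^ 2) + 2 * (∫ x in (0 : ℝ)..1, w x * Ux t x) +
        ∫ x in (0 : ℝ)..1, 2 * (U t x - v.toReal x) * source p (U t x)) t := by
  have cv : ContinuousOn (Function.uncurry fun (_ : ℝ) x => v.toReal x) strip :=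
    (v.continuous_toReal.comp continuous_snd).continuousOn
  have cd : ContinuousOn (Function.uncurry fun t x => U t x - v.toReal x) strip := h.cont.sub cv
  have hsq : ContinuousOn (Function.uncurry fun t x => (U t x - v.toReal x) ^ 2) strip := cd.pow 2
  have h1 := hasDerivAt_integral_strip (F := fun t x => (U t x - v.toReal x) ^ 2)
    (F' := fun t x => 2 * (U t x - v.toReal x) * (Uxx t x + source p (U t x)))
    hsq (((continuousOn_const (c := (2 : ℝ))).mul cd).mul (h.cont_t hp))
    (fun s hs x hx => by simpa using ((h.deriv_t s hs x hx).sub_const (v.toReal x)).fun_pow 2) ht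
  refine h1.congr_deriv ?_
  have cx := continuousOn_slice h.cont_xx ht
  have cU := continuousOn_slice h.cont ht
  have cs := continuousOn_slice (h.cont_source hp) ht
  have cv' := v.continuous_toReal.continuousOn (s := Icc 0 1)
  have e2 := h.integral_deriv_mul_deriv ht ht
  have e3 := hw.integral_mul_deriv (h.deriv_xx t ht) cx
  simp only [← pow_two] at e2
  have i1 : IntervalIntegrable (fun x => 2 * (U t x * Uxx t x)) volume 0 1 :=
    (intervalIntegrable_of_continuousOn_Icc (cU.mul cx)).const_mul 2
  have i2 : IntervalIntegrable (fun x => 2 * (v.toReal x * Uxx t x)) volume 0 1 :=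
    (intervalIntegrable_of_continuousOn_Icc (cv'.mul cx)).const_mul 2
  have i3 : IntervalIntegrable (fun x => 2 * (U t x - v.toReal x) * source p (U t x)) volume 0 1 :=
    intervalIntegrable_of_continuousOn_Icc ((continuousOn_const.mul (cU.sub cv')).mul cs)
  calc ∫ x in (0 : ℝ)..1, 2 * (U t x - v.toReal x) * (Uxx t x + source p (U t x))
      = ∫ x in (0 : ℝ)..1, (2 * (U t x * Uxx t x) - 2 * (v.toReal x * Uxx t x)
          + 2 * (U t x - v.toReal x) * source p (U t x)) := by congr 1; ext x; ring
    _ = _ := by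
      rw [intervalIntegral.integral_add (i1.sub i2) i3, intervalIntegral.integral_sub i1 i2,
        intervalIntegral.integral_const_mul, intervalIntegral.integral_const_mul, e3]
      rw [e2]; ring

theorem CD.abs_toReal_le (v : CD) (x : ℝ) : |v.toReal x| ≤ ‖v.1‖ :=
  v.1.norm_coe_le_norm (projIcc 0 1 zero_le_one x)

/-- The primitive of the source term is Lipschitz on bounded intervals. -/
theorem abs_rpow_div_sub_le {p K r s : ℝ} (hp : 1 < p) (hr : |r| ≤ K) (hs : |s| ≤ K) :
    |r| ^ (p + 1) / (p + 1) - |s| ^ (p + 1) / (p + 1) ≤ K ^ p * |r - s| := by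
  have := (convex_Icc (-K) K).norm_image_sub_le_of_norm_hasDerivWithin_le
    (f := fun r => |r| ^ (p + 1) / (p + 1)) (f' := source p) (C := K ^ p)
    (fun x _ => (hasDerivAt_abs_rpow_div hp x).hasDerivWithinAt)
    (fun x hx => by
      rw [Real.norm_eq_abs, abs_source hp]
      exact Real.rpow_le_rpow (abs_nonneg x) (abs_le.2 hx) (by linarith))
    (abs_le.1 hs) (abs_le.1 hr)
  exact (le_abs_self _).trans this

/-- The differential identities hold only for positive times; continuity up to `t = 0` links them to
the initial datum. -/
theorem IsGlobalSolution.continuousOn_integral_sq_sub {p : ℝ} {u v : CD} {U : ℝ → ℝ → ℝ}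
    (h : IsGlobalSolution p u U) {T K : ℝ}
    (hK : ∀ t ∈ Icc 0 T, ∀ x ∈ Icc (0 : ℝ) 1, |U t x - v.toReal x| ≤ K) :
    ContinuousOn (fun t => ∫ x in (0 : ℝ)..1, (U t x - v.toReal x) ^ 2) (Icc 0 T) := by
  have hmem : ∀ x ∈ uIoc (0 : ℝ) 1, x ∈ Icc (0 : ℝ) 1 := fun x hx => by
    rw [uIoc_of_le zero_le_one] at hx; exact Ioc_subset_Icc_self hx
  intro t ht
  refine intervalIntegral.continuousWithinAt_of_dominated_interval (bound := fun _ => K ^ 2)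
    ?_ ?_ (by simp) ?_
  · filter_upwards [self_mem_nhdsWithin] with s hs
    have hc : ContinuousOn (fun x => (U s x - v.toReal x) ^ 2) (Icc 0 1) :=
      ((h.continuousOn.comp (f := fun x => (s, x)) (by fun_prop) fun _ hx => ⟨hs.1, hx⟩).sub
        v.continuous_toReal.continuousOn).pow 2
    rw [uIoc_of_le zero_le_one]
    exact (hc.mono Ioc_subset_Icc_self).aestronglyMeasurable measurableSet_Ioc
  · filter_upwards [self_mem_nhdsWithin] with s hs
    refine Eventually.of_forall fun x hx => ?_
    rw [Real.norm_eq_abs, abs_pow]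
    exact pow_le_pow_left₀ (abs_nonneg _) (hK s hs x (hmem x hx)) 2
  · refine Eventually.of_forall fun x hx => ?_
    have hc : ContinuousOn (fun s => U s x) (Icc 0 T) :=
      h.continuousOn.comp (f := fun s => (s, x)) (by fun_prop) fun _ hs => ⟨hs.1, hmem x hx⟩
    exact ((hc t ht).sub continuousWithinAt_const).pow 2

/-- Solutions starting uniformly close to `v ∈ H¹₀` are, at some positive time, close to `v` in
`L²` and have energy not much larger than that of `v`. -/
theorem exists_time_energy_le {p : ℝ} (hp : 1 < p) {v : CD} {w : ℝ → ℝ}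
    (hw : IsL2WeakDeriv v.toReal w) :
    ∃ ε : ℝ, 0 < ε ∧ ∀ (u : CD) (U Ux Uxx : ℝ → ℝ → ℝ), IsGlobalSolution p u U →
      IsClassical p U Ux Uxx → dist u.1 v.1 ≤ ε → ∃ s, 0 < s ∧
        (∫ x in (0 : ℝ)..1, (U s x - v.toReal x) ^ 2) ≤ 1 ∧
        IsClassical.energy p U Ux s ≤ (1 / 2) * (∫ x in (0 : ℝ)..1, w x ^ 2) -
          (∫ x in (0 : ℝ)..1, |v.toReal x| ^ (p + 1) / (p + 1)) + 1 := by
  set A := ‖v.1‖ + 1 with hA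
  set K := A + 1 with hKdef
  set G := K ^ p with hG
  set W := ∫ x in (0 : ℝ)..1, w x ^ 2 with hW
  have hA0 : 0 ≤ A := by positivity
  have hK0 : 0 < K := by linarith
  have hG0 : 0 < G := Real.rpow_pos_of_pos hK0 p
  have hW0 : 0 ≤ W := intervalIntegral.integral_nonneg zero_le_one fun x _ => sq_nonneg _
  -- `R` is a crude bound for the growth rate of `φ`, from `φ ≤ (2K)²`. `ρ` is the allowed size of
  -- `φ`, with `G² ρ ≤ 1/16`; `T` satisfies `R T ≤ ρ/2`. Finally `ε ≤ ρ/2` keeps `φ ≤ ρ` on `[0,T]`,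
  -- and `ε ≤ T/8` is less than the drop `T/4` used below.
  set R := W + 2 * G ^ 2 * (2 * K) ^ 2 + 1 / 2 with hR
  have hR0 : 0 < R := by positivity
  set ρ := 1 / (16 * (G ^ 2 + 1)) with hρ
  have hρ0 : 0 < ρ := by positivity
  have hρ1 : ρ ≤ 1 := by rw [hρ, div_le_one (by positivity)]; nlinarith [sq_nonneg G]
  have hGρ : G ^ 2 * ρ ≤ 1 / 16 := by
    rw [hρ, mul_one_div, div_le_div_iff₀ (by positivity) (by norm_num)]; nlinarith
  set δ := 1 / (2 * ((A + 1) ^ p + 1)) with hδ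
  have hδ0 : 0 < δ := by positivity
  set T := min δ (ρ / (2 * R)) with hT
  have hT0 : 0 < T := lt_min hδ0 (by positivity)
  have hTR : R * T ≤ ρ / 2 := by
    have : T ≤ ρ / (2 * R) := min_le_right _ _
    calc R * T ≤ R * (ρ / (2 * R)) := mul_le_mul_of_nonneg_left this hR0.le
      _ = ρ / 2 := by field_simp
  set ε := min (min 1 (ρ / 2)) (T / 8) with hε
  have hε0 : 0 < ε := lt_min (lt_min one_pos (by positivity)) (by positivity)
  have hε1 : ε ≤ 1 := (min_le_left _ _).trans (min_le_left _ _)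
  have hερ : ε ≤ ρ / 2 := (min_le_left _ _).trans (min_le_right _ _)
  have hεT : ε ≤ T / 8 := min_le_right _ _
  have hεsq : ε ^ 2 ≤ ε := by nlinarith
  refine ⟨ε, hε0, fun u U Ux Uxx h hcl hd => ?_⟩
  have hcv := v.continuous_toReal.continuousOn (s := Icc 0 1)
  have hu : ∀ x : unitInterval, |u.1 x| ≤ A := fun x => by
    have h1 : |u.1 x - v.1 x| ≤ ε := (ContinuousMap.dist_apply_le_dist x).trans hd
    have h2 : |v.1 x| ≤ ‖v.1‖ := v.1.norm_coe_le_norm x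
    have h3 := abs_add_le (u.1 x - v.1 x) (v.1 x)
    rw [sub_add_cancel] at h3
    linarith
  have hUK : ∀ t ∈ Icc 0 T, ∀ x ∈ Icc (0 : ℝ) 1, |U t x| ≤ K := fun t ht =>
    h.abs_le_of_initial_le hp hA0 hu t ⟨ht.1, ht.2.trans (min_le_left _ _)⟩
  have hvK : ∀ x, |v.toReal x| ≤ K := fun x => (v.abs_toReal_le x).trans (by linarith)
  have hdK : ∀ t ∈ Icc 0 T, ∀ x ∈ Icc (0 : ℝ) 1, |U t x - v.toReal x| ≤ 2 * K :=
    fun t ht x hx => (abs_sub _ _).trans (by linarith [hUK t ht x hx, hvK x])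
  set φ : ℝ → ℝ := fun t => ∫ x in (0 : ℝ)..1, (U t x - v.toReal x) ^ 2 with hφ
  have hφc : ContinuousOn φ (Icc 0 T) := h.continuousOn_integral_sq_sub hdK
  have hφ0 : φ 0 ≤ ε := by
    refine le_trans ?_ hεsq
    have hb : ∀ x ∈ Ioc (0 : ℝ) 1, (U 0 x - v.toReal x) ^ 2 ≤ ε ^ 2 := fun x hx => by
      have hx' := Ioc_subset_Icc_self hx
      rw [h.initial ⟨x, hx'⟩, show v.toReal x = v.1 ⟨x, hx'⟩ from v.toReal_coe ⟨x, hx'⟩,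
        ← sq_abs]
      exact pow_le_pow_left₀ (abs_nonneg _) ((ContinuousMap.dist_apply_le_dist _).trans hd) 2
    have := intervalIntegral.norm_integral_le_of_norm_le_const (a := 0) (b := 1) (C := ε ^ 2)
      (f := fun x => (U 0 x - v.toReal x) ^ 2) (fun x hx => by
        rw [uIoc_of_le zero_le_one] at hx
        rw [Real.norm_eq_abs, abs_of_nonneg (sq_nonneg _)]
        exact hb x hx)
    simpa using (le_abs_self _).trans this
  set φ' : ℝ → ℝ := fun t => -2 * (∫ x in (0 : ℝ)..1, Ux t x ^ 2) +
    2 * (∫ x in (0 : ℝ)..1, w x * Ux t x) +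
      ∫ x in (0 : ℝ)..1, 2 * (U t x - v.toReal x) * source p (U t x) with hφ'
  have hφd : ∀ t, 0 < t → HasDerivAt φ (φ' t) t := fun t ht =>
    hcl.hasDerivAt_integral_sq_sub hp hw ht
  have hiφ : ∀ t, 0 < t →
      IntervalIntegrable (fun x => (U t x - v.toReal x) ^ 2) volume 0 1 := fun t ht =>
    intervalIntegrable_of_continuousOn_Icc (((continuousOn_slice hcl.cont ht).sub hcv).pow 2)
  have hiD : ∀ t, 0 < t → IntervalIntegrable (fun x => Ux t x ^ 2) volume 0 1 := fun t ht =>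
    intervalIntegrable_of_continuousOn_Icc ((continuousOn_slice hcl.cont_x ht).pow 2)
  have hφle : ∀ t ∈ Ioc 0 T,
      φ' t ≤ -(∫ x in (0 : ℝ)..1, Ux t x ^ 2) + W + 2 * G ^ 2 * φ t + 1 / 2 := by
    intro t ht
    -- Young's inequality spends only one of the two copies of `-∫ U_x²`; the other remains as
    -- dissipation.
    have hcross : 2 * (∫ x in (0 : ℝ)..1, w x * Ux t x) ≤
        W + ∫ x in (0 : ℝ)..1, Ux t x ^ 2 := by
      rw [hW, ← intervalIntegral.integral_add hw.integrable_sq (hiD t ht.1),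
        ← intervalIntegral.integral_const_mul]
      refine intervalIntegral.integral_mono_on zero_le_one ?_
        (hw.integrable_sq.add (hiD t ht.1)) fun x _ => by nlinarith [sq_nonneg (w x - Ux t x)]
      refine (hw.intervalIntegrable.mul_continuousOn ?_).const_mul 2
      rw [uIcc_of_le zero_le_one]; exact continuousOn_slice hcl.cont_x ht.1
    have hsrc : ∫ x in (0 : ℝ)..1, 2 * (U t x - v.toReal x) * source p (U t x) ≤
        2 * G ^ 2 * φ t + 1 / 2 := by
      have he : 2 * G ^ 2 * φ t + 1 / 2 =
          ∫ x in (0 : ℝ)..1, (2 * G ^ 2 * (U t x - v.toReal x) ^ 2 + 1 / 2) := by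
        rw [intervalIntegral.integral_add ((hiφ t ht.1).const_mul _) (by simp),
          intervalIntegral.integral_const_mul]
        simp [hφ]
      rw [he]
      refine intervalIntegral.integral_mono_on zero_le_one
        (intervalIntegrable_of_continuousOn_Icc ((continuousOn_const.mul
          ((continuousOn_slice hcl.cont ht.1).sub hcv)).mul
          (continuousOn_slice (hcl.cont_source hp) ht.1)))
        (((hiφ t ht.1).const_mul _).add (by simp)) fun x hx => ?_
      have hs : |source p (U t x)| ≤ G := by
        rw [abs_source hp]
        exact Real.rpow_le_rpow (abs_nonneg _) (hUK t ⟨ht.1.le, ht.2⟩ x hx) (by linarith)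
      calc 2 * (U t x - v.toReal x) * source p (U t x)
          ≤ |2 * (U t x - v.toReal x) * source p (U t x)| := le_abs_self _
        _ = 2 * |U t x - v.toReal x| * |source p (U t x)| := by
            rw [abs_mul, abs_mul, abs_two]
        _ ≤ 2 * |U t x - v.toReal x| * G := by gcongr
        _ ≤ 2 * G ^ 2 * (U t x - v.toReal x) ^ 2 + 1 / 2 := by
            rw [← sq_abs (U t x - v.toReal x)]
            nlinarith [sq_nonneg (2 * G * |U t x - v.toReal x| - 1)]
    simp only [hφ']
    linarith
  have hφK : ∀ t ∈ Icc 0 T, φ t ≤ (2 * K) ^ 2 := by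
    intro t ht
    have := intervalIntegral.norm_integral_le_of_norm_le_const (a := 0) (b := 1)
      (C := (2 * K) ^ 2) (f := fun x => (U t x - v.toReal x) ^ 2) (fun x hx => by
        rw [uIoc_of_le zero_le_one] at hx
        rw [Real.norm_eq_abs, abs_pow]
        exact pow_le_pow_left₀ (abs_nonneg _) (hdK t ht x (Ioc_subset_Icc_self hx)) 2)
    simpa using (le_abs_self _).trans this
  have hgrow : ∀ B : ℝ, (∀ t ∈ Ioo 0 T, φ' t ≤ B) → ∀ t ∈ Icc 0 T, φ t ≤ φ 0 + B * t := by
    intro B hB t ht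
    have := (convex_Icc 0 T).image_sub_le_mul_sub_of_deriv_le hφc
      (fun t ht => by
        rw [interior_Icc] at ht
        exact (hφd t ht.1).differentiableAt.differentiableWithinAt)
      (C := B) (fun t ht => by
        rw [interior_Icc] at ht
        rw [(hφd t ht.1).deriv]; exact hB t ht) 0 (left_mem_Icc.2 hT0.le) t ht ht.1
    linarith
  have hDnn : ∀ t, 0 ≤ ∫ x in (0 : ℝ)..1, Ux t x ^ 2 := fun t =>
    intervalIntegral.integral_nonneg zero_le_one fun x _ => sq_nonneg _
  have hφρ : ∀ t ∈ Icc 0 T, φ t ≤ ρ := by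
    intro t ht
    have h1 := hgrow R (fun t ht => by
      have h2 := hφle t ⟨ht.1, ht.2.le⟩
      have h3 := mul_le_mul_of_nonneg_left (hφK t ⟨ht.1.le, ht.2.le⟩)
        (show 0 ≤ 2 * G ^ 2 by positivity)
      linarith [hDnn t]) t ht
    have h4 := mul_le_mul_of_nonneg_left ht.2 hR0.le
    linarith
  have hGφ : ∀ t ∈ Icc 0 T, G ^ 2 * φ t ≤ 1 / 16 := fun t ht =>
    (mul_le_mul_of_nonneg_left (hφρ t ht) (sq_nonneg G)).trans hGρ
  -- Otherwise `φ' ≤ -1 + 1/8 + 1/2 ≤ -1/4` on `(0,T)`, and `φ T ≤ ε - T/4 < 0`.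
  obtain ⟨s, hs, hsD⟩ : ∃ s ∈ Ioo 0 T, ∫ x in (0 : ℝ)..1, Ux s x ^ 2 ≤ W + 1 := by
    by_contra! hcon
    have h1 := hgrow (-(1 / 4)) (fun t ht => by
      have := hφle t ⟨ht.1, ht.2.le⟩
      linarith [hcon t ht, hGφ t ⟨ht.1.le, ht.2.le⟩]) T (right_mem_Icc.2 hT0.le)
    have h2 : 0 ≤ φ T := intervalIntegral.integral_nonneg zero_le_one fun x _ => sq_nonneg _
    linarith
  have hsI : s ∈ Icc 0 T := Ioo_subset_Icc_self hs
  refine ⟨s, hs.1, (hφρ s hsI).trans hρ1, ?_⟩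
  have hpow : (∫ x in (0 : ℝ)..1, |v.toReal x| ^ (p + 1) / (p + 1)) -
      (∫ x in (0 : ℝ)..1, |U s x| ^ (p + 1) / (p + 1)) ≤ G ^ 2 * φ s + 1 / 4 := by
    have he : G ^ 2 * φ s + 1 / 4 =
        ∫ x in (0 : ℝ)..1, (G ^ 2 * (U s x - v.toReal x) ^ 2 + 1 / 4) := by
      rw [intervalIntegral.integral_add ((hiφ s hs.1).const_mul _) (by simp),
        intervalIntegral.integral_const_mul]
      simp [hφ]
    have iv : IntervalIntegrable (fun x => |v.toReal x| ^ (p + 1) / (p + 1)) volume 0 1 :=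
      intervalIntegrable_of_continuousOn_Icc
        ((hcv.abs.rpow_const fun _ _ => Or.inr (by linarith)).div_const _)
    have iU : IntervalIntegrable (fun x => |U s x| ^ (p + 1) / (p + 1)) volume 0 1 :=
      intervalIntegrable_of_continuousOn_Icc
        ((continuousOn_slice (hcl.cont_abs_rpow hp) hs.1).div_const _)
    rw [he, ← intervalIntegral.integral_sub iv iU]
    refine intervalIntegral.integral_mono_on zero_le_one (iv.sub iU)
      (((hiφ s hs.1).const_mul _).add (by simp)) fun x hx => ?_
    refine (abs_rpow_div_sub_le hp (hvK x) (hUK s hsI x hx)).trans ?_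
    rw [abs_sub_comm, ← sq_abs (U s x - v.toReal x)]
    nlinarith [sq_nonneg (2 * G * |U s x - v.toReal x| - 1)]
  -- The energy excess is at most `1/2` from the Dirichlet part and `1/16 + 1/4` from the power
  -- part, below `1` in total.
  have := hGφ s hsI
  rw [IsClassical.energy]
  linarith

/-! ### Interpolation, the `L²` bound on the closure, and the conclusion. -/

/-- Interpolation of the supremum norm between `L²` and `H¹₀`. -/
theorem norm_pow_four_le {v : CD} {w : ℝ → ℝ} (hw : IsL2WeakDeriv v.toReal w) :
    ‖v.1‖ ^ 4 ≤ 4 * (∫ x in (0 : ℝ)..1, w x ^ 2) * ∫ x in (0 : ℝ)..1, v.toReal x ^ 2 := by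
  have hcv := v.continuous_toReal
  obtain ⟨x₀, hx₀⟩ : ∃ x₀ : unitInterval, ‖v.1‖ = ‖v.1 x₀‖ := by
    obtain ⟨x₀, -, hx₀⟩ := isCompact_univ.exists_isMaxOn (univ_nonempty (α := unitInterval))
      (v.1.continuous.norm.continuousOn)
    exact ⟨x₀, le_antisymm ((v.1.norm_le (norm_nonneg _)).2 fun x => hx₀ (mem_univ x))
      (v.1.norm_coe_le_norm x₀)⟩
  have hsub : uIcc (0 : ℝ) x₀ ⊆ uIcc 0 1 := by
    rw [uIcc_of_le x₀.2.1, uIcc_of_le zero_le_one]; exact Icc_subset_Icc_right x₀.2.2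
  have hwx : IntervalIntegrable w volume 0 x₀ := hw.intervalIntegrable.mono_set hsub
  have hprim : ∀ x ∈ Icc (0 : ℝ) x₀, v.toReal x = v.toReal 0 + ∫ y in (0 : ℝ)..x, w y :=
    fun x hx => by
      rw [v.toReal_zero, zero_add]; exact hw.eq_integral x ⟨hx.1, hx.2.trans x₀.2.2⟩
  -- Integrating `v` against its own derivative up to the point where `|v|` is maximal gives `‖v‖² =
  -- 2 ∫ v w`.
  have hsq := integral_mul_eq_sub_of_primitive x₀.2.1 hwx hwx hprim hprim
  have hcomm : ∫ x in (0 : ℝ)..x₀, w x * v.toReal x = ∫ x in (0 : ℝ)..x₀, v.toReal x * w x := by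
    simp only [mul_comm]
  rw [hcomm, v.toReal_zero, v.toReal_coe] at hsq
  have hm : ‖v.1‖ ^ 2 = 2 * ∫ x in (0 : ℝ)..x₀, v.toReal x * w x := by
    rw [hx₀, Real.norm_eq_abs, sq_abs]; linarith
  have i1 := hw.integrable_sq
  have i2 : IntervalIntegrable (fun x => v.toReal x ^ 2) volume 0 1 :=
    (hcv.pow 2).intervalIntegrable _ _
  -- Cauchy–Schwarz through the discriminant of a nonnegative quadratic in `k`; the discriminant
  -- supplies the factor `4`.
  have hdisc : ∀ k : ℝ, 0 ≤ (∫ x in (0 : ℝ)..1, w x ^ 2) * (k * k) + (-‖v.1‖ ^ 2) * k +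
      ∫ x in (0 : ℝ)..1, v.toReal x ^ 2 := by
    intro k
    have i3 : IntervalIntegrable (fun x => k ^ 2 * w x ^ 2 + v.toReal x ^ 2) volume 0 1 :=
      (i1.const_mul _).add i2
    have h1 : ∫ x in (0 : ℝ)..x₀, 2 * k * (v.toReal x * w x) ≤
        ∫ x in (0 : ℝ)..x₀, (k ^ 2 * w x ^ 2 + v.toReal x ^ 2) :=
      intervalIntegral.integral_mono_on x₀.2.1
        ((hwx.continuousOn_mul hcv.continuousOn).const_mul _) (i3.mono_set hsub)
        fun x _ => by nlinarith [sq_nonneg (k * w x - v.toReal x)]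
    have h2 : ∫ x in (0 : ℝ)..x₀, (k ^ 2 * w x ^ 2 + v.toReal x ^ 2) ≤
        ∫ x in (0 : ℝ)..1, (k ^ 2 * w x ^ 2 + v.toReal x ^ 2) :=
      intervalIntegral.integral_mono_interval le_rfl x₀.2.1 x₀.2.2
        (Eventually.of_forall fun x => by simp only [Pi.zero_apply]; positivity) i3
    rw [intervalIntegral.integral_add (i1.const_mul _) i2,
      intervalIntegral.integral_const_mul] at h2
    rw [intervalIntegral.integral_const_mul] at h1
    rw [hm]
    linarith
  have := discrim_le_zero hdisc
  rw [discrim] at this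
  nlinarith

/-- A real upper bound excludes the value `⊤`, so the extended-real condition becomes a real
inequality with a genuine weak derivative. -/
theorem exists_weakDeriv_of_potential_le {p a : ℝ} (hp : 1 < p) {v : CD}
    (h : potential p v ≤ (a : EReal)) : ∃ w, IsL2WeakDeriv v.toReal w ∧
      (1 / 2) * (∫ x in (0 : ℝ)..1, w x ^ 2) -
        (∫ x in (0 : ℝ)..1, |v.toReal x| ^ (p + 1) / (p + 1)) ≤ a := by
  by_cases hv : MemH10 v
  · have hw : IsL2WeakDeriv v.toReal (weakDeriv v) := by
      rw [weakDeriv, dif_pos hv]; exact hv.choose_spec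
    refine ⟨weakDeriv v, hw, ?_⟩
    rw [potential, if_pos hv, EReal.coe_le_coe_iff, ← integral_Ioc_eq_integral_Ioo,
      ← intervalIntegral.integral_of_le zero_le_one, intervalIntegral.integral_sub
        (hw.integrable_sq.const_mul _), intervalIntegral.integral_const_mul] at h
    · exact h
    · exact ((v.continuous_toReal.abs.rpow_const fun _ => Or.inr (by linarith)).div_const
        _).intervalIntegrable _ _
  · rw [potential, if_neg hv] at h
    exact absurd h (not_le.2 (EReal.coe_lt_top a))

/-- Elements of the closure of the domain of attraction with bounded potential are bounded
in `L²`. -/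
theorem exists_integral_sq_le_of_potential_le {p : ℝ} (hp : 1 < p) (a : ℝ) :
    ∃ Y : ℝ, 0 < Y ∧ ∀ v : CD, v ∈ closure (domainOfAttraction p) → potential p v ≤ (a : EReal) →
      ∫ x in (0 : ℝ)..1, v.toReal x ^ 2 ≤ Y := by
  -- The extra `1` is the energy excess allowed by `exists_time_energy_le`.
  obtain ⟨Y, hY, hYb⟩ := exists_integral_sq_le hp (a + 1)
  refine ⟨2 * Y + 2, by linarith, fun v hv hpot => ?_⟩
  obtain ⟨w, hw, hE⟩ := exists_weakDeriv_of_potential_le hp hpot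
  obtain ⟨ε, hε, H⟩ := exists_time_energy_le hp hw
  obtain ⟨u, ⟨U, hU, -⟩, hd⟩ := Metric.mem_closure_iff.1 hv ε hε
  obtain ⟨Ux, Uxx, hcl⟩ := hU.exists_isClassical
  obtain ⟨s, hs, h1, h2⟩ := H u U Ux Uxx hU hcl (by rw [dist_comm]; exact hd.le)
  have h3 := hYb U Ux Uxx hcl s hs (by linarith)
  have cU := continuousOn_slice hcl.cont hs
  have cv := v.continuous_toReal.continuousOn (s := Icc 0 1)
  have i1 : IntervalIntegrable (fun x => 2 * U s x ^ 2) volume 0 1 :=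
    intervalIntegrable_of_continuousOn_Icc (continuousOn_const.mul (cU.pow 2))
  have i2 : IntervalIntegrable (fun x => 2 * (U s x - v.toReal x) ^ 2) volume 0 1 :=
    intervalIntegrable_of_continuousOn_Icc (continuousOn_const.mul ((cU.sub cv).pow 2))
  calc ∫ x in (0 : ℝ)..1, v.toReal x ^ 2
      ≤ ∫ x in (0 : ℝ)..1, (2 * U s x ^ 2 + 2 * (U s x - v.toReal x) ^ 2) :=
        intervalIntegral.integral_mono_on zero_le_one
          (intervalIntegrable_of_continuousOn_Icc (cv.pow 2)) (i1.add i2)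
          fun x _ => by nlinarith [sq_nonneg (2 * U s x - v.toReal x)]
    _ ≤ 2 * Y + 2 := by
        rw [intervalIntegral.integral_add i1 i2, intervalIntegral.integral_const_mul,
          intervalIntegral.integral_const_mul]
        linarith

end BlowUpPDE

end

theorem lemma5p1 (p : ℝ) (hp1 : 1 < p) (hp5 : p < 5) (a : ℝ) (ha : 0 < a) :
    ∃ M : ℝ, ∀ u : BlowUpPDE.CD, u ∈ closure (BlowUpPDE.domainOfAttraction p) →
      BlowUpPDE.potential p u ≤ (a : EReal) → ‖u.1‖ ≤ M := by
  obtain ⟨Y, hY, hYb⟩ := BlowUpPDE.exists_integral_sq_le_of_potential_le hp1 a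
  set C := 8 * Y * (a + Y) with hC
  have hC0 : 0 ≤ C := by positivity
  refine ⟨max 1 (C ^ (1 / (5 - p))), fun v hv hpot => ?_⟩
  obtain ⟨w, hw, hE⟩ := BlowUpPDE.exists_weakDeriv_of_potential_le hp1 hpot
  have hF := hYb v hv hpot
  rcases le_total ‖v.1‖ 1 with hm1 | hm1
  · exact hm1.trans (le_max_left _ _)
  refine le_trans ?_ (le_max_right _ _)
  set m := ‖v.1‖ with hm
  have hm0 : 0 < m := one_pos.trans_le hm1
  set P := m ^ (p - 1) with hP
  have hP1 : 1 ≤ P := Real.one_le_rpow hm1 (by linarith)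
  have hcv := v.continuous_toReal
  have hpow : ∫ x in (0 : ℝ)..1, |v.toReal x| ^ (p + 1) / (p + 1) ≤ P * Y := by
    refine le_trans ?_ (mul_le_mul_of_nonneg_left hF (by linarith))
    rw [← intervalIntegral.integral_const_mul]
    refine intervalIntegral.integral_mono_on zero_le_one
      (((hcv.abs.rpow_const fun _ => Or.inr (by linarith)).div_const _).intervalIntegrable _ _)
      ((continuous_const.mul (hcv.pow 2)).intervalIntegrable _ _) fun x _ => ?_
    refine (div_le_self (Real.rpow_nonneg (abs_nonneg _) _) (by linarith)).trans ?_
    rw [← BlowUpPDE.mul_source hp1, BlowUpPDE.source, ← mul_assoc, ← pow_two, mul_comm]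
    exact mul_le_mul_of_nonneg_right
      (Real.rpow_le_rpow (abs_nonneg _) (v.abs_toReal_le x) (by linarith)) (sq_nonneg _)
  -- From `½ ∫ w² ≤ a + P Y`, where `a ≤ a P` because `P ≥ 1`; this is why the case `‖v‖ ≤ 1` is
  -- split off.
  have hW : ∫ x in (0 : ℝ)..1, w x ^ 2 ≤ 2 * (a + Y) * P := by nlinarith
  have hW0 : 0 ≤ ∫ x in (0 : ℝ)..1, w x ^ 2 :=
    intervalIntegral.integral_nonneg zero_le_one fun x _ => sq_nonneg _
  have hm4 : m ^ 4 ≤ C * P := by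
    refine (BlowUpPDE.norm_pow_four_le hw).trans ?_
    calc 4 * (∫ x in (0 : ℝ)..1, w x ^ 2) * ∫ x in (0 : ℝ)..1, v.toReal x ^ 2
        ≤ 4 * (∫ x in (0 : ℝ)..1, w x ^ 2) * Y := mul_le_mul_of_nonneg_left hF (by linarith)
      _ ≤ 4 * (2 * (a + Y) * P) * Y := by gcongr
      _ = C * P := by rw [hC]; ring
  -- Subcriticality enters here: dividing `m⁴ ≤ C m^(p-1)` by `m^(p-1)` leaves the positive power `5
  -- - p` of `m`.
  have hsplit : m ^ (5 - p) * P = m ^ 4 := by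
    rw [hP, ← Real.rpow_add hm0, ← Real.rpow_natCast]; congr 1; push_cast; ring
  have hle : m ^ (5 - p) ≤ C := le_of_mul_le_mul_right (hsplit ▸ hm4) (by linarith)
  calc m = (m ^ (5 - p)) ^ (1 / (5 - p)) := by
        rw [← Real.rpow_mul hm0.le, mul_one_div_cancel (by linarith), Real.rpow_one]
    _ ≤ C ^ (1 / (5 - p)) := Real.rpow_le_rpow (Real.rpow_nonneg hm0.le _) hle
        (one_div_nonneg.2 (by linarith))
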